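/- Let $\mathcal S_g$ be the compact oriented surface of genus $g$. A map of genus $g$ is a graph (loops and multiple edges allowed) properly embedded in $\mathcal S_g$ such that all faces are discs; maps are considered up to orientation-preserving homeomorphism. A rooted map has a distinguished arc (oriented edge) $\vec e$, the root; its origin is the root vertex and the face on its right is the root face. A pointed map has a distinguished vertex $v_0$, the basepoint. A bipartite quadrangulation is a map whose faces all have degree $4$ and whose vertices can be properly coloured with two colours. A $g$-tree is a map of genus $g$ with exactly one face. A rooted map is embedded if its vertices carry integer labels that differ by at most $1$ along every edge, the root vertex having label $1$; it is well labeled if moreover the minimum label is $1$. The opening $\phi(\mathfrak q,v_0)$ of a pointed bipartite quadrangulation is obtained as follows: label each vertex by its distance to $v_0$; the vertices of $\phi(\mathfrak q,v_0)$ are those of $\mathfrak q$ except $v_0$, and it has one edge for each face $f$ of $\mathfrak q$, drawn inside $f$ and joining the two corners of $f$ whose label is larger than that of the preceding corner in clockwise direction around $f$. If $\mathfrak q$ is rooted at $\vec e$, then $\phi(\mathfrak q,v_0)$ is rooted at the new edge $\vec{e'}$ created in the root face, oriented as follows: let $c$ be the corner of the root face, at the end of its border arc $\vec e$, that belongs to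 the extremity of $\vec e$ with the larger label. If $\vec{e'}$ is incident to $c$, its origin is at $c$; otherwise its origin is the first of its two end corners that is met after $c$ in clockwise direction around the root face (the label of this origin is again the larger label of $\vec e$). Let $s=+1$ if the labels increase along $\vec e$ and $s=-1$ otherwise. Let $\nu$ translate all labels of a labelled rooted map such that the root vertex gets label $1$. For all integers $g\ge 0$ and $n\ge0$: 1. The opening, with $v_0$ the root vertex of $\mathfrak q$, gives well labeled $g$-trees and induces a bijection from rooted bipartite quadrangulations of genus $g$ with $n$ faces onto rooted well labeled $g$-trees with $n$ edges. 2. The map $(\mathfrak q,\vec e,v_0)\mapsto\bigl(\nu(\phi(\mathfrak q,v_0),\vec{e'}),\,s\bigr)$ gives embedded $g$-trees and induces a bijection from rooted pointed bipartite quadrangulations of genus $g$ with $n$ faces onto pairs formed by a rooted embedded $g$-tree with $n$ edges and a sign $\pm1$. 3. Let $\vec q^{\,\bullet}_{g,n}$ and $a_{g,n}$ be the numbers of rooted pointed bipartite quadrangulations of genus $g$ with $n$ faces and of rooted embedded $g$-trees with $n$ edges, with the conventions $a_{0,0}=1$ (the tree without edges) and $\vec q^{\,\bullet}_{0,0}=2$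 (the map with a single edge and two vertices, taken as the quadrangulation with no faces) for the degenerate terms. These numbers are finite, they vanish for $n<2g$, and the series $\overrightarrow{Q_g}^{\bullet}(z)=\sum_{n\ge 2g}\vec q^{\,\bullet}_{g,n}z^n$ and $T_g(z)=\sum_{n\ge 2g}a_{g,n}z^n$ satisfy $$\overrightarrow{Q_g}^{\bullet}(z)=2\,T_g(z).$$ -/

import Mathlib

/-- A graph drawn on oriented surfaces, described by the local arrangement of its arcs.
`D` is the set of arcs (oriented edges), `rot` sends an arc to the next arc with the same origin
in counterclockwise order around that origin, and `rev` sends an arc to the opposite arc. -/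
structure RotationSystem (D : Type) where
  rot : Equiv.Perm D
  rev : Equiv.Perm D

namespace RotationSystem

/-- The vertices: an arc is in the class of its origin. -/
abbrev Vertex {D : Type} (M : RotationSystem D) : Type :=
  Quotient (Equiv.Perm.SameCycle.setoid M.rot)

/-- The (unoriented) edges. -/
abbrev Edge {D : Type} (M : RotationSystem D) : Type :=
  Quotient (Equiv.Perm.SameCycle.setoid M.rev)

/-- The successor of an arc `d` on the border of the face on the right of `d`. Iterating `next` is
walking around that face in clockwise direction. -/
def next {D : Type} (M : RotationSystem D) : Equiv.Perm D := M.rot * M.rev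

/-- The faces: an arc is in the class of the face on its right. -/
abbrev Face {D : Type} (M : RotationSystem D) : Type :=
  Quotient (Equiv.Perm.SameCycle.setoid M.next)

/-- The origin of an arc. -/
def vertex {D : Type} (M : RotationSystem D) (d : D) : M.Vertex := Quotient.mk _ d

/-- The face on the right of an arc. -/
def face {D : Type} (M : RotationSystem D) (d : D) : M.Face := Quotient.mk _ d

/-- The underlying graph. Loops and multiplicities of edges, which do not matter for connectedness
and for distances, are forgotten here (and only here). -/
def graph {D : Type} (M : RotationSystem D) : SimpleGraph M.Vertex :=
  SimpleGraph.fromRel fun u v => ∃ d, M.vertex d = u ∧ M.vertex (M.rev d) = v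

/-- `M` is a map: each arc has an opposite arc, and the graph is connected. (The faces of a
connected rotation system are discs by construction.) -/
structure IsMap {D : Type} (M : RotationSystem D) : Prop where
  rev_rev : ∀ d, M.rev (M.rev d) = d
  rev_ne : ∀ d, M.rev d ≠ d
  connected : M.graph.Connected

/-- A map of genus `g`, the genus being given by Euler's formula. -/
structure IsMapOfGenus {D : Type} (M : RotationSystem D) (g : ℕ) : Prop extends M.IsMap where
  euler : (Nat.card M.Vertex : ℤ) - Nat.card M.Edge + Nat.card M.Face = 2 - 2 * g

/-- The vertices can be coloured with two colours such that each edge has ends of different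
colours. -/
def IsBipartite {D : Type} (M : RotationSystem D) : Prop :=
  ∃ c : M.Vertex → Bool, ∀ d, c (M.vertex d) ≠ c (M.vertex (M.rev d))

/-- The degree of a face: the number of sides of edges on its border. -/
noncomputable def faceDegree {D : Type} (M : RotationSystem D) (f : M.Face) : ℕ :=
  Nat.card {d : D // M.face d = f}

/-- `M` is a bipartite quadrangulation of genus `g` with `n` faces. -/
structure IsBipartiteQuadrangulation {D : Type} (M : RotationSystem D) (g n : ℕ) : Prop
    extends M.IsMapOfGenus g where
  bipartite : M.IsBipartite
  degree_eq_four : ∀ f, M.faceDegree f = 4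
  card_face : Nat.card M.Face = n

/-- `M` is a `g`-tree with `n` edges: a map of genus `g` with one face. -/
structure IsGTree {D : Type} (M : RotationSystem D) (g n : ℕ) : Prop
    extends M.IsMapOfGenus g where
  card_face : Nat.card M.Face = 1
  card_edge : Nat.card M.Edge = n

/-- The bijection `e` between arcs carries `M` onto `M'` (it is induced by an
orientation-preserving homeomorphism). -/
def Carries {D D' : Type} (M : RotationSystem D) (M' : RotationSystem D') (e : D ≃ D') : Prop :=
  (∀ d, e (M.rot d) = M'.rot (e d)) ∧ ∀ d, e (M.rev d) = M'.rev (e d)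

theorem Carries.refl {D : Type} (M : RotationSystem D) : M.Carries M (Equiv.refl D) :=
  ⟨fun _ => rfl, fun _ => rfl⟩

theorem Carries.symm {D D' : Type} {M : RotationSystem D} {M' : RotationSystem D'} {e : D ≃ D'}
    (h : M.Carries M' e) : M'.Carries M e.symm :=
  ⟨fun d => by rw [Equiv.symm_apply_eq, h.1, Equiv.apply_symm_apply],
    fun d => by rw [Equiv.symm_apply_eq, h.2, Equiv.apply_symm_apply]⟩

theorem Carries.trans {D D' D'' : Type} {M : RotationSystem D} {M' : RotationSystem D'}
    {M'' : RotationSystem D''} {e : D ≃ D'} {e' : D' ≃ D''} (h : M.Carries M' e)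
    (h' : M'.Carries M'' e') : M.Carries M'' (e.trans e') :=
  ⟨fun d => by simp [h.1, h'.1], fun d => by simp [h.2, h'.2]⟩

end RotationSystem

/-! ### First return permutations -/

theorem exists_return {D : Type} [Finite D] (f : Equiv.Perm D) (p : D → Prop) (d : {d // p d}) :
    ∃ k, 0 < k ∧ p ((f ^ k) d.1) :=
  ⟨orderOf f, orderOf_pos f, by simpa [pow_orderOf_eq_one] using d.2⟩

open Classical in
/-- The first element satisfying `p` among `f d`, `f (f d)`, ... -/
noncomputable def firstReturnFun {D : Type} [Finite D] (f : Equiv.Perm D) (p : D → Prop)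
    (d : {d // p d}) : {d // p d} :=
  ⟨(f ^ Nat.find (exists_return f p d)) d.1, (Nat.find_spec (exists_return f p d)).2⟩

theorem firstReturnFun_injective {D : Type} [Finite D] (f : Equiv.Perm D) (p : D → Prop) :
    Function.Injective (firstReturnFun f p) := by
  classical
  have key : ∀ x y : {d // p d}, firstReturnFun f p x = firstReturnFun f p y →
      Nat.find (exists_return f p x) ≤ Nat.find (exists_return f p y) → x = y := by
    intro x y hxy hle
    have h1 : (f ^ Nat.find (exists_return f p x)) x.1
        = (f ^ Nat.find (exists_return f p y)) y.1 := congrArg Subtype.val hxy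
    obtain ⟨m, hm⟩ := Nat.exists_eq_add_of_le hle
    rw [hm, pow_add, Equiv.Perm.mul_apply] at h1
    have h2 := (f ^ Nat.find (exists_return f p x)).injective h1
    rcases Nat.eq_zero_or_pos m with h0 | hpos
    · subst h0
      exact Subtype.ext (by simpa using h2)
    · have h3 := Nat.find_min' (exists_return f p y) ⟨hpos, by rw [← h2]; exact x.2⟩
      have h4 := (Nat.find_spec (exists_return f p x)).1
      omega
  intro x y hxy
  rcases le_total (Nat.find (exists_return f p x)) (Nat.find (exists_return f p y)) with h | h
  · exact key x y hxy h
  · exact (key y x hxy.symm h).symm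

/-- The permutation that `f` induces on the elements satisfying `p`, in the cyclic order in which
these elements occur along the cycles of `f`. -/
noncomputable def firstReturn {D : Type} [Finite D] (f : Equiv.Perm D) (p : D → Prop) :
    Equiv.Perm {d // p d} :=
  Equiv.ofBijective (firstReturnFun f p)
    (Finite.injective_iff_bijective.mp (firstReturnFun_injective f p))

/-! ### The opening -/

namespace RotationSystem

/-- The distance labelling: the distance to `v₀` of the origin of an arc. -/
noncomputable def distLabel {D : Type} (M : RotationSystem D) (v₀ : M.Vertex) (d : D) : ℕ :=
  M.graph.dist (M.vertex d) v₀

/-- The arc `d` also stands for the corner between `d` and the arc that precedes `d` in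
counterclockwise order around its origin; this corner lies in the face on the right of `d`.
The corner is *marked* if its label is larger than that of the preceding corner in clockwise
direction around this face. -/
def IsMarked {D : Type} (M : RotationSystem D) (v₀ : M.Vertex) (d : D) : Prop :=
  M.distLabel v₀ (M.next.symm d) < M.distLabel v₀ d

/-- The opening. It has one arc for each marked corner. Around a vertex these arcs occur in the
order of the corners, and each of them is opposite to the next marked corner around the same face:
a face of a pointed bipartite quadrangulation has exactly two marked corners, which are thus joined
by an edge. (Each vertex except the basepoint has a marked corner.) -/
noncomputable def opening {D : Type} [Finite D] (M : RotationSystem D) (v₀ : M.Vertex) :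
    RotationSystem {d // M.IsMarked v₀ d} where
  rot := firstReturn M.rot (M.IsMarked v₀)
  rev := firstReturn M.next (M.IsMarked v₀)

theorem vertex_next {D : Type} (M : RotationSystem D) (d : D) :
    M.vertex (M.next d) = M.vertex (M.rev d) :=
  Quotient.sound (s := Equiv.Perm.SameCycle.setoid M.rot)
    (⟨-1, by simp [next]⟩ : M.rot.SameCycle (M.next d) (M.rev d))

theorem distLabel_next_ne {D : Type} {M : RotationSystem D} (hM : M.IsMap) (hb : M.IsBipartite)
    (v₀ : M.Vertex) (d : D) : M.distLabel v₀ (M.next d) ≠ M.distLabel v₀ d := by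
  obtain ⟨c, hc⟩ := hb
  let C : M.graph.Coloring Bool := SimpleGraph.Coloring.mk c (by
    intro u v h
    rcases (SimpleGraph.fromRel_adj _ u v).mp h with ⟨-, ⟨d, rfl, rfl⟩ | ⟨d, rfl, rfl⟩⟩
    · exact hc d
    · exact (hc d).symm)
  obtain ⟨p, hp⟩ := hM.connected.exists_walk_length_eq_dist (M.vertex (M.next d)) v₀
  obtain ⟨q, hq⟩ := hM.connected.exists_walk_length_eq_dist (M.vertex d) v₀
  intro h
  unfold distLabel at h
  have e1 := C.even_length_iff_congr p
  have e2 := C.even_length_iff_congr q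
  rw [hp, h, ← hq, e2, M.vertex_next] at e1
  apply hc d
  change C (M.vertex d) = C (M.vertex (M.rev d))
  grind

theorem exists_marked {D : Type} [Finite D] {M : RotationSystem D} (hM : M.IsMap)
    (hb : M.IsBipartite) (v₀ : M.Vertex) (d : D) : ∃ k, M.IsMarked v₀ ((M.next ^ k) d) := by
  by_contra! h
  have step : ∀ k, M.distLabel v₀ ((M.next ^ (k + 1)) d)
      ≤ M.distLabel v₀ ((M.next ^ k) d) := by
    intro k
    have := h (k + 1)
    simpa [IsMarked, pow_succ'] using this
  have anti := antitone_nat_of_succ_le (f := fun k => M.distLabel v₀ ((M.next ^ k) d)) step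
  have h1 := anti (show 1 ≤ orderOf M.next from orderOf_pos _)
  have h2 := step 0
  simp only [pow_orderOf_eq_one, pow_one, zero_add, pow_zero, Equiv.Perm.one_apply] at h1 h2
  exact distLabel_next_ne hM hb v₀ d (le_antisymm h2 h1)

open Classical in
/-- The corner, in the face on the right of the arc `r`, of the extremity of `r` with the largest
label: that of the endpoint of `r` if labels increase along `r`, that of its origin otherwise. -/
noncomputable def topCorner {D : Type} (M : RotationSystem D) (v₀ : M.Vertex) (r : D) : D :=
  if M.distLabel v₀ r < M.distLabel v₀ (M.rev r) then M.next r else r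

open Classical in
/-- The root of the opening: the edge created in the face on the right of the root `r`, oriented
so that its origin is at the corner of the extremity of `r` with the largest label.
When this corner is not an end of the new edge (`r` then leads from the last to the first corner of
a face with labels `i-1, i, i+1, i`), the origin is the first end of the new edge in clockwise
direction after this corner, which has the same label `i`. -/
noncomputable def openingRoot {D : Type} [Finite D] {M : RotationSystem D} (hM : M.IsMap)
    (hb : M.IsBipartite) (v₀ : M.Vertex) (r : D) : {d // M.IsMarked v₀ d} :=
  ⟨(M.next ^ Nat.find (exists_marked hM hb v₀ (M.topCorner v₀ r))) (M.topCorner v₀ r),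
    Nat.find_spec (exists_marked hM hb v₀ (M.topCorner v₀ r))⟩

end RotationSystem

/-! ### Rooted, pointed and labelled maps -/

/-- A rotation system with a root arc. -/
structure RootedMap where
  D : Type
  finite_D : Finite D
  M : RotationSystem D
  root : D

/-- A rotation system with a root arc and a basepoint. -/
structure RootedPointedMap extends RootedMap where
  base : M.Vertex

/-- A rotation system with a root arc and labels; `lab d` is the label of the origin of `d`. -/
structure RootedLabelledMap extends RootedMap where
  lab : D → ℤ

/-- Rooted maps are considered the same if an orientation-preserving homeomorphism carries one onto
the other together with the root. -/
instance RootedMap.setoid : Setoid RootedMap where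
  r q q' := ∃ e : q.D ≃ q'.D, q.M.Carries q'.M e ∧ e q.root = q'.root
  iseqv :=
    { refl := fun q => ⟨Equiv.refl _, .refl _, rfl⟩
      symm := fun ⟨e, h, hr⟩ => ⟨e.symm, h.symm, by rw [← hr, Equiv.symm_apply_apply]⟩
      trans := fun ⟨e, h, hr⟩ ⟨e', h', hr'⟩ => ⟨e.trans e', h.trans h', by simp [hr, hr']⟩ }

/-- The same with basepoints. -/
instance RootedPointedMap.setoid : Setoid RootedPointedMap where
  r q q' := ∃ e : q.D ≃ q'.D, q.M.Carries q'.M e ∧ e q.root = q'.root ∧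
    ∀ d, q.M.vertex d = q.base ↔ q'.M.vertex (e d) = q'.base
  iseqv :=
    { refl := fun q => ⟨Equiv.refl _, .refl _, rfl, fun _ => Iff.rfl⟩
      symm := fun ⟨e, h, hr, hb⟩ => ⟨e.symm, h.symm, by rw [← hr, Equiv.symm_apply_apply],
        fun d => by rw [hb, Equiv.apply_symm_apply]⟩
      trans := fun ⟨e, h, hr, hb⟩ ⟨e', h', hr', hb'⟩ =>
        ⟨e.trans e', h.trans h', by simp [hr, hr'], fun d => (hb d).trans (hb' (e d))⟩ }

/-- The same with labels. -/
instance RootedLabelledMap.setoid : Setoid RootedLabelledMap where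
  r t t' := ∃ e : t.D ≃ t'.D, t.M.Carries t'.M e ∧ e t.root = t'.root ∧
    ∀ d, t'.lab (e d) = t.lab d
  iseqv :=
    { refl := fun q => ⟨Equiv.refl _, .refl _, rfl, fun _ => rfl⟩
      symm := fun ⟨e, h, hr, hb⟩ => ⟨e.symm, h.symm, by rw [← hr, Equiv.symm_apply_apply],
        fun d => by rw [← hb, Equiv.apply_symm_apply]⟩
      trans := fun ⟨e, h, hr, hb⟩ ⟨e', h', hr', hb'⟩ =>
        ⟨e.trans e', h.trans h', by simp [hr, hr'], fun d => (hb' (e d)).trans (hb d)⟩ }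

/-- A rooted embedded map: labels are functions of the vertices, they differ at most by one along
every edge, and the root vertex has label `1`. -/
structure RootedLabelledMap.IsEmbedded (t : RootedLabelledMap) : Prop where
  lab_rot : ∀ d, t.lab (t.M.rot d) = t.lab d
  lab_rev : ∀ d, |t.lab (t.M.rev d) - t.lab d| ≤ 1
  lab_root : t.lab t.root = 1

/-- A rooted well labelled map: an embedded map with minimum label `1`. -/
structure RootedLabelledMap.IsWellLabelled (t : RootedLabelledMap) : Prop extends t.IsEmbedded where
  isLeast : IsLeast (Set.range t.lab) 1

/-- Translate all labels such that the root vertex gets label `1`. -/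
def RootedLabelledMap.relabel (t : RootedLabelledMap) : RootedLabelledMap where
  toRootedMap := t.toRootedMap
  lab d := t.lab d - t.lab t.root + 1

/-- Rooted bipartite quadrangulations of genus `g` with `n` faces (representatives). -/
abbrev RootedQuad (g n : ℕ) : Type 1 :=
  {q : RootedMap // q.M.IsBipartiteQuadrangulation g n}

/-- Rooted pointed bipartite quadrangulations of genus `g` with `n` faces (representatives). -/
abbrev RootedPointedQuad (g n : ℕ) : Type 1 :=
  {q : RootedPointedMap // q.M.IsBipartiteQuadrangulation g n}

/-- Rooted well labelled `g`-trees with `n` edges (representatives). -/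
abbrev RootedWellLabelledTree (g n : ℕ) : Type 1 :=
  {t : RootedLabelledMap // t.M.IsGTree g n ∧ t.IsWellLabelled}

/-- Rooted embedded `g`-trees with `n` edges (representatives). -/
abbrev RootedEmbeddedTree (g n : ℕ) : Type 1 :=
  {t : RootedLabelledMap // t.M.IsGTree g n ∧ t.IsEmbedded}

/-- Rooted bipartite quadrangulations of genus `g` with `n` faces, up to isomorphism. -/
abbrev RootedQuadClass (g n : ℕ) : Type 1 :=
  Quotient (RootedMap.setoid.comap (Subtype.val : RootedQuad g n → RootedMap))

/-- Rooted pointed bipartite quadrangulations of genus `g` with `n` faces, up to isomorphism. -/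
abbrev RootedPointedQuadClass (g n : ℕ) : Type 1 :=
  Quotient (RootedPointedMap.setoid.comap (Subtype.val : RootedPointedQuad g n → RootedPointedMap))

/-- Rooted well labelled `g`-trees with `n` edges, up to isomorphism. -/
abbrev RootedWellLabelledTreeClass (g n : ℕ) : Type 1 :=
  Quotient (RootedLabelledMap.setoid.comap
    (Subtype.val : RootedWellLabelledTree g n → RootedLabelledMap))

/-- Rooted embedded `g`-trees with `n` edges, up to isomorphism. -/
abbrev RootedEmbeddedTreeClass (g n : ℕ) : Type 1 :=
  Quotient (RootedLabelledMap.setoid.comap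
    (Subtype.val : RootedEmbeddedTree g n → RootedLabelledMap))

/-- The opening of a rooted pointed bipartite quadrangulation, with its root and labelled by the
distances to the basepoint. -/
noncomputable def RootedPointedQuad.opened {g n : ℕ} (q : RootedPointedQuad g n) :
    RootedLabelledMap :=
  haveI : Finite q.1.D := q.1.finite_D
  { D := {d // q.1.M.IsMarked q.1.base d}
    finite_D := inferInstance
    M := q.1.M.opening q.1.base
    root := RotationSystem.openingRoot q.2.toIsMap q.2.bipartite q.1.base q.1.root
    lab := fun d => q.1.M.distLabel q.1.base d.1 }

/-- A rooted quadrangulation is pointed at its root vertex. -/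
def RootedQuad.pointAtRoot {g n : ℕ} (q : RootedQuad g n) : RootedPointedQuad g n :=
  ⟨{ toRootedMap := q.1, base := q.1.M.vertex q.1.root }, q.2⟩

open Classical in
/-- The sign: `1` if the distance labels increase along the root arc, `-1` otherwise. -/
noncomputable def RootedPointedQuad.sign {g n : ℕ} (q : RootedPointedQuad g n) : ℤˣ :=
  if q.1.M.distLabel q.1.base q.1.root < q.1.M.distLabel q.1.base (q.1.M.rev q.1.root)
  then 1 else -1

/-- The number of rooted pointed bipartite quadrangulations of genus `g` with `n` faces. By
convention the map with one edge and two vertices (it has one rooting and two basepoints) is the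
planar quadrangulation without quadrangular faces. -/
noncomputable def pointedQuadCount (g n : ℕ) : ℕ :=
  if g = 0 ∧ n = 0 then 2 else Nat.card (RootedPointedQuadClass g n)

/-- The number of rooted embedded `g`-trees with `n` edges. By convention the plane tree
without edges (which has no root arc) counts as a rooted tree. -/
noncomputable def embeddedTreeCount (g n : ℕ) : ℕ :=
  if g = 0 ∧ n = 0 then 1 else Nat.card (RootedEmbeddedTreeClass g n)

/-- The generating series of rooted pointed bipartite quadrangulations of genus `g` with respect to
the number of faces. -/
noncomputable def pointedQuadSeries (g : ℕ) : PowerSeries ℤ :=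
  PowerSeries.mk fun n => (pointedQuadCount g n : ℤ)

/-- The generating series of rooted embedded `g`-trees with respect to the number of edges. -/
noncomputable def embeddedTreeSeries (g : ℕ) : PowerSeries ℤ :=
  PowerSeries.mk fun n => (embeddedTreeCount g n : ℤ)

/-! ### Permutations of finite types -/

section Perm

open Equiv.Perm

/-! The opening has an explicit inverse, the closure. In a one-face map with labels of minimum `1`,
the corners are cyclically ordered by `next`; each corner `c` is joined to the next corner with a
smaller label, or to an added vertex `v₀` if `ℓ c = 1`. The proof compares two kinds of walks:
rotation around a vertex of the quadrangulation and the walk around the single face of the one-face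
map. Their common language is `Excursion`, a stretch of a walk above a given level. Labels fall by
at most one per step, so a first descent to a level hits it exactly.

The relation `Turn` describes the rotation of the closure in terms of the labelled one-face map
alone. It is deterministic (`Turn.right_unique`), injective (`turn_left_unique`) and total
(`exists_turn`), hence a permutation.

From quadrangulations to trees: `excursion_up` and `excursion_down` compare consecutive arcs around
a vertex with excursions around the opening. They show that the opening has only one face
(`opening_next_sameCycle`) and that the quadrangulation rotates according to `Turn`
(`turn_arcEquiv`), so that its labelled opening determines it. The genus is preserved because one
vertex is lost, faces become edges, and `E = 2F` in a quadrangulation.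

From trees to quadrangulations: `closure_face` computes the faces of the closure,
`closure_connected_and_distLabel` recognises its labels as distances, and `closureEquiv_carries`
finds the original map as the opening.

Roots: the new root together with the sign is a bijective function of the old root, whence the
factor `2`. Pointing at the root vertex amounts to sign `1` and root label `1`. Translating labels
loses nothing, since the minimum of an opening is known to be `1`. -/

theorem firstReturn_eq_of_pow {D : Type} [Finite D] {f : Equiv.Perm D} {p : D → Prop}
    {x y : {d // p d}} {k : ℕ} (hk : 0 < k) (h : (f ^ k) x.1 = y.1)
    (hmin : ∀ j, 0 < j → j < k → ¬ p ((f ^ j) x.1)) : firstReturn f p x = y := by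
  classical
  apply Subtype.ext
  change (f ^ Nat.find (exists_return f p x)) x.1 = y.1
  have hfind : Nat.find (exists_return f p x) = k := by
    rw [Nat.find_eq_iff]
    refine ⟨⟨hk, by rw [h]; exact y.2⟩, fun j hj hc => hmin j hc.1 hj hc.2⟩
  rw [hfind, h]

theorem exists_pow_firstReturn {D : Type} [Finite D] (f : Equiv.Perm D) (p : D → Prop)
    (x : {d // p d}) : ∃ k, 0 < k ∧ (f ^ k) x.1 = (firstReturn f p x).1 ∧
      ∀ j, 0 < j → j < k → ¬ p ((f ^ j) x.1) := by
  classical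
  exact ⟨Nat.find (exists_return f p x), (Nat.find_spec (exists_return f p x)).1, rfl,
    fun j hj hlt hp => Nat.find_min (exists_return f p x) hlt ⟨hj, hp⟩⟩

/-- A first return stays in its cycle of `f`, and conversely an iterate of `f` that ends in `p`
splits into first returns. Vertices and edges of an opening can thus be counted in the original map.
-/
theorem sameCycle_firstReturn {D : Type} [Finite D] (f : Equiv.Perm D) (p : D → Prop)
    (x y : {d // p d}) : (firstReturn f p).SameCycle x y ↔ f.SameCycle x.1 y.1 := by
  have step : ∀ x : {d // p d}, f.SameCycle x.1 (firstReturn f p x).1 := fun x => by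
    obtain ⟨k, -, hk, -⟩ := exists_pow_firstReturn f p x
    exact ⟨k, by simpa using hk⟩
  constructor
  · intro h
    obtain ⟨n, rfl⟩ := h.exists_nat_pow_eq
    induction n with
    | zero => exact SameCycle.refl _ _
    | succ n ih =>
      rw [pow_succ', mul_apply]
      exact (ih ⟨n, by simp⟩).trans (step _)
  · intro h
    obtain ⟨n, hn⟩ := h.exists_nat_pow_eq
    clear h
    induction n using Nat.strong_induction_on generalizing x with
    | _ n ih =>
      rcases Nat.eq_zero_or_pos n with rfl | hpos
      · have : x = y := Subtype.ext (by simpa using hn)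
        exact this ▸ SameCycle.refl _ _
      · obtain ⟨k, hk, hkx, hmin⟩ := exists_pow_firstReturn f p x
        have hle : k ≤ n := by
          by_contra! hlt
          exact hmin n hpos hlt (hn ▸ y.2)
        obtain ⟨m, rfl⟩ := Nat.exists_eq_add_of_le' hle
        rw [pow_add, mul_apply, hkx] at hn
        have h1 := ih m (by omega) _ hn
        exact SameCycle.trans (⟨1, by simp⟩ : (firstReturn f p).SameCycle x _) h1

theorem firstReturn_conj {D D' : Type} [Finite D] [Finite D'] {f : Equiv.Perm D}
    {f' : Equiv.Perm D'} {p : D → Prop} {p' : D' → Prop} (e : D ≃ D') (he : ∀ d, e (f d) = f' (e d))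
    (hp : ∀ d, p d ↔ p' (e d)) (x : {d // p d}) :
    firstReturn f' p' ⟨e x.1, (hp _).1 x.2⟩
      = ⟨e (firstReturn f p x).1, (hp _).1 (firstReturn f p x).2⟩ := by
  have hpow : ∀ k d, e ((f ^ k) d) = (f' ^ k) (e d) := by
    intro k d
    induction k with
    | zero => simp
    | succ k ih => rw [pow_succ', pow_succ', mul_apply, mul_apply, he, ih]
  obtain ⟨k, hk, hkx, hmin⟩ := exists_pow_firstReturn f p x
  exact firstReturn_eq_of_pow hk (by rw [← hpow, hkx])
    fun j hj hlt hc => hmin j hj hlt ((hp _).2 (by rwa [hpow]))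

theorem sameCycle_iff_of_conj {D D' : Type} {f : Equiv.Perm D} {f' : Equiv.Perm D'} (e : D ≃ D')
    (he : ∀ d, e (f d) = f' (e d)) (x y : D) : f.SameCycle x y ↔ f'.SameCycle (e x) (e y) := by
  have h : f' = (e.symm.trans f).trans e := by
    ext d
    simp [he]
  have hz : ∀ n : ℤ, (f' ^ n) (e x) = e ((f ^ n) x) := by
    intro n
    have h1 : f' = e.permCongrHom f := by rw [h]; rfl
    rw [h1, ← map_zpow]
    simp [Equiv.permCongrHom]
  simp only [SameCycle, hz, e.apply_eq_iff_eq]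

theorem natCard_sameCycle {D : Type} [Finite D] (f : Equiv.Perm D) (d : D) :
    Nat.card {x // f.SameCycle d x} = Function.minimalPeriod f d := by
  classical
  have := Fintype.ofFinite D
  have h := MulAction.minimalPeriod_eq_card (a := f) (b := d)
  change Function.minimalPeriod f d = _ at h
  rw [h, ← Nat.card_eq_fintype_card]
  refine Nat.card_congr (Equiv.subtypeEquivRight fun x => ?_)
  constructor
  · rintro ⟨n, rfl⟩
    exact ⟨⟨f ^ n, n, rfl⟩, rfl⟩
  · rintro ⟨⟨_, n, rfl⟩, rfl⟩
    exact ⟨n, rfl⟩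

theorem natCard_mk_eq {D : Type} [Finite D] (f : Equiv.Perm D) (d : D) :
    Nat.card {x // (Quotient.mk (SameCycle.setoid f) x) = Quotient.mk _ d}
      = Function.minimalPeriod f d := by
  rw [← natCard_sameCycle]
  refine Nat.card_congr (Equiv.subtypeEquivRight fun x => ?_)
  rw [Quotient.eq]
  exact sameCycle_comm

/-- The fibres of the quotient map are the cycles. Applied to `rev` with `m = 2` and to `next` with
`m = 4`. -/
theorem natCard_eq_mul_of_minimalPeriod {D : Type} [Finite D] (f : Equiv.Perm D) (m : ℕ)
    (h : ∀ d, Function.minimalPeriod f d = m) :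
    Nat.card D = m * Nat.card (Quotient (SameCycle.setoid f)) := by
  classical
  have := Fintype.ofFinite (Quotient (SameCycle.setoid f))
  rw [Nat.card_congr (Equiv.sigmaFiberEquiv (Quotient.mk (SameCycle.setoid f))).symm,
    Nat.card_sigma]
  have : ∀ q : Quotient (SameCycle.setoid f), Nat.card {x // Quotient.mk _ x = q} = m := by
    intro q
    induction q using Quotient.inductionOn with
    | h d => rw [natCard_mk_eq, h]
  simp only [this, Finset.sum_const, Finset.card_univ, smul_eq_mul, Nat.card_eq_fintype_card]
  ring

end Perm

/-! ### Excursions -/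

/-- Iterating `f` leads from `c` to `d` through labels larger than `h`. -/
def Excursion {C : Type} (f : Equiv.Perm C) (ℓ : C → ℤ) (h : ℤ) (c d : C) : Prop :=
  ∃ k, 0 < k ∧ (f ^ k) c = d ∧ ∀ j, 0 < j → j < k → h < ℓ ((f ^ j) c)

namespace Excursion

variable {C : Type} {f : Equiv.Perm C} {ℓ : C → ℤ} {h : ℤ} {c d e : C}

theorem single (f : Equiv.Perm C) (ℓ : C → ℤ) (h : ℤ) (c : C) : Excursion f ℓ h c (f c) :=
  ⟨1, one_pos, by simp, fun j h1 h2 => by omega⟩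

theorem mono {h' : ℤ} (H : Excursion f ℓ h c d) (hh : h' ≤ h) : Excursion f ℓ h' c d := by
  obtain ⟨k, hk, hkd, hj⟩ := H
  exact ⟨k, hk, hkd, fun j h1 h2 => hh.trans_lt (hj j h1 h2)⟩

theorem trans (H : Excursion f ℓ h c d) (hd : h < ℓ d) (H' : Excursion f ℓ h d e) :
    Excursion f ℓ h c e := by
  obtain ⟨k, hk, rfl, hj⟩ := H
  obtain ⟨m, hm, rfl, hi⟩ := H'
  refine ⟨m + k, by omega, by rw [pow_add, Equiv.Perm.mul_apply], fun j h1 h2 => ?_⟩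
  rcases lt_trichotomy j k with hlt | rfl | hgt
  · exact hj j h1 hlt
  · exact hd
  · obtain ⟨i, rfl⟩ := Nat.exists_eq_add_of_le' hgt.le
    rw [pow_add, Equiv.Perm.mul_apply]
    exact hi i (by omega) (by omega)

theorem sameCycle (H : Excursion f ℓ h c d) : f.SameCycle c d := by
  obtain ⟨k, -, rfl, -⟩ := H
  exact ⟨k, by simp⟩

theorem symm (H : Excursion f ℓ h c d) : Excursion f⁻¹ ℓ h d c := by
  obtain ⟨k, hk, rfl, hj⟩ := H
  refine ⟨k, hk, by simp, fun j h1 h2 => ?_⟩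
  have : (f⁻¹ ^ j) ((f ^ k) c) = (f ^ (k - j)) c := by
    obtain ⟨i, rfl⟩ := Nat.exists_eq_add_of_le h2.le
    rw [pow_add, Equiv.Perm.mul_apply]
    simp
  rw [this]
  exact hj _ (by omega) (by omega)

/-- Both ends are the first point at level `h` or below met after `c`. -/
theorem right_unique (H : Excursion f ℓ h c d) (H' : Excursion f ℓ h c e) (hd : ℓ d ≤ h)
    (he : ℓ e ≤ h) : d = e := by
  obtain ⟨k, hk, rfl, hj⟩ := H
  obtain ⟨m, hm, rfl, hi⟩ := H'
  rcases lt_trichotomy k m with hlt | rfl | hgt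
  · exact absurd (hi k hk hlt) hd.not_gt
  · rfl
  · exact absurd (hj m hm hgt) he.not_gt

theorem left_unique (H : Excursion f ℓ h c e) (H' : Excursion f ℓ h d e) (hc : ℓ c ≤ h)
    (hd : ℓ d ≤ h) : c = d :=
  H.symm.right_unique H'.symm hc hd

theorem apply_eq_or_lt (H : Excursion f ℓ h c d) : f c = d ∨ h < ℓ (f c) := by
  obtain ⟨k, hk, rfl, hj⟩ := H
  rcases Nat.lt_or_ge 1 k with h1 | h1
  · exact .inr (by simpa using hj 1 one_pos h1)
  · obtain rfl : k = 1 := by omega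
    exact .inl (by simp)

theorem inv_apply_eq_or_lt (H : Excursion f ℓ h c d) : f⁻¹ d = c ∨ h < ℓ (f⁻¹ d) :=
  H.symm.apply_eq_or_lt

theorem of_apply (H : Excursion f ℓ h (f c) d) (hc : h < ℓ (f c)) : Excursion f ℓ h c d :=
  (single f ℓ h c).trans hc H

theorem map {C' : Type} {f' : Equiv.Perm C'} {ℓ' : C' → ℤ} (e : C ≃ C')
    (he : ∀ c, e (f c) = f' (e c)) (hl : ∀ c, ℓ' (e c) = ℓ c) (H : Excursion f ℓ h c d) :
    Excursion f' ℓ' h (e c) (e d) := by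
  have hpow : ∀ k, e ((f ^ k) c) = (f' ^ k) (e c) := by
    intro k
    induction k with
    | zero => simp
    | succ k ih => rw [pow_succ', pow_succ', Equiv.Perm.mul_apply, Equiv.Perm.mul_apply, he, ih]
  obtain ⟨k, hk, rfl, hj⟩ := H
  exact ⟨k, hk, (hpow k).symm, fun j h1 h2 => by rw [← hpow, hl]; exact hj j h1 h2⟩

/-- If labels decrease by at most one along `f`, then the first visit to the labels at most `h`,
starting above `h` or just before a label at least `h`, is a visit to `h`. -/
theorem exists_of_sameCycle [Finite C] (hf : ∀ x, ℓ x - 1 ≤ ℓ (f x)) (hc : h < ℓ c ∨ h ≤ ℓ (f c))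
    (hs : f.SameCycle c e) (he : ℓ e ≤ h) : ∃ d, Excursion f ℓ h c d ∧ ℓ d = h := by
  classical
  have hex : ∃ k, 0 < k ∧ ℓ ((f ^ k) c) ≤ h := by
    obtain ⟨k, hk, -, rfl⟩ := hs.exists_pow_eq''
    exact ⟨k, hk, he⟩
  obtain ⟨h1, h2⟩ := Nat.find_spec hex
  have hmin : ∀ j, 0 < j → j < Nat.find hex → h < ℓ ((f ^ j) c) := fun j hj hlt => by
    have := Nat.find_min hex hlt
    push Not at this
    exact this hj
  refine ⟨_, ⟨Nat.find hex, h1, rfl, hmin⟩, le_antisymm h2 ?_⟩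
  obtain ⟨m, hm⟩ := Nat.exists_eq_add_of_lt h1
  rw [zero_add] at hm
  rw [hm, pow_succ', Equiv.Perm.mul_apply]
  -- Either the visit is the very first step, governed by `hc`, or the preceding point is above `h`
  -- and a decrease by at most one cannot jump over `h`.
  rcases Nat.eq_zero_or_pos m with rfl | hpos
  · rcases hc with hc | hc
    · have := hf c
      simp only [pow_zero, Equiv.Perm.one_apply]
      omega
    · simpa using hc
  · have := hmin m hpos (by omega)
    have := hf ((f ^ m) c)
    omega

end Excursion

/-! ### The rotation of the closure -/

namespace RotationSystem

/-- An arc `c` of a labelled one-face map stands for the corner on its right, from which the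
closure draws an edge to the next corner with a smaller label; the two arcs of this edge are
`(c, true)`, with origin at the corner `c`, and `(c, false)`. The relation describes the next
arc in counterclockwise order around the origin. -/
inductive Turn {C : Type} (T : RotationSystem C) (ℓ : C → ℤ) : C × Bool → C × Bool → Prop
  | down_up (c : C) (h : ℓ (T.rev c) = ℓ c + 1) : Turn T ℓ (c, true) (T.rev c, false)
  | down_down (c : C) (h : ℓ (T.rev c) ≠ ℓ c + 1) : Turn T ℓ (c, true) (T.rot c, true)
  | up_up (c c' : C) (h : Excursion T.next ℓ (ℓ c) c' c) (hl : ℓ c' = ℓ c) :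
      Turn T ℓ (c, false) (c', false)
  | up_down (c d : C) (hc : ℓ (T.next⁻¹ c) = ℓ c - 1) (h : Excursion T.next ℓ (ℓ c - 1) c d)
      (hd : ℓ d = ℓ c - 1) : Turn T ℓ (c, false) (d, true)

/-- Labels of the vertices that differ by at most one along every edge of a map with one face. -/
structure IsLabelledOneFace {C : Type} (T : RotationSystem C) (ℓ : C → ℤ) : Prop where
  rev_rev : ∀ c, T.rev (T.rev c) = c
  rev_ne : ∀ c, T.rev c ≠ c
  next_sameCycle : ∀ c d, T.next.SameCycle c d
  lab_rot : ∀ c, ℓ (T.rot c) = ℓ c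
  lab_rev : ∀ c, |ℓ (T.rev c) - ℓ c| ≤ 1

theorem next_apply {D : Type} (M : RotationSystem D) (d : D) : M.next d = M.rot (M.rev d) := rfl

theorem next_rev {D : Type} {M : RotationSystem D} (h : ∀ d, M.rev (M.rev d) = d) (d : D) :
    M.next (M.rev d) = M.rot d := by
  rw [next_apply, h]

theorem Carries.next {D D' : Type} {M : RotationSystem D} {M' : RotationSystem D'} {e : D ≃ D'}
    (h : M.Carries M' e) (d : D) : e (M.next d) = M'.next (e d) := by
  rw [next_apply, next_apply, h.1, h.2]

theorem Turn.map {C C' : Type} {T : RotationSystem C} {T' : RotationSystem C'} {ℓ : C → ℤ}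
    {ℓ' : C' → ℤ} {e : C ≃ C'} (he : T.Carries T' e) (hl : ∀ c, ℓ' (e c) = ℓ c)
    {x y : C × Bool} (h : Turn T ℓ x y) :
    Turn T' ℓ' (Prod.map e id x) (Prod.map e id y) := by
  cases h with
  | down_up c h =>
    simp only [Prod.map_apply, id, he.2]
    exact .down_up _ (by rw [← he.2, hl, hl, h])
  | down_down c h =>
    simp only [Prod.map_apply, id, he.1]
    exact .down_down _ (by rwa [← he.2, hl, hl])
  | up_up c c' h hc =>
    exact .up_up _ _ (by rw [hl]; exact h.map e he.next hl) (by rw [hl, hl, hc])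
  | up_down c d hc h hd =>
    refine .up_down _ _ ?_ (by rw [hl]; exact h.map e he.next hl) (by rw [hl, hl, hd])
    have : T'.next⁻¹ (e c) = e (T.next⁻¹ c) := by
      rw [Equiv.Perm.inv_eq_iff_eq, ← he.next]; simp
    rw [this, hl, hl, hc]

/-- For an up arc, an excursion above `ℓ c` ending at `c` arrives from a label at least `ℓ c`, which
is incompatible with `ℓ (T.next⁻¹ c) = ℓ c - 1`; so only one of the two rules applies. Within a
rule, uniqueness of the ends of excursions fixes the target. -/
theorem Turn.right_unique {C : Type} {T : RotationSystem C} {ℓ : C → ℤ} {x y z : C × Bool}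
    (h : Turn T ℓ x y) (h' : Turn T ℓ x z) : y = z := by
  cases h with
  | down_up c h =>
    cases h' with
    | down_up => rfl
    | down_down _ h' => exact absurd h h'
  | down_down c h =>
    cases h' with
    | down_up _ h' => exact absurd h' h
    | down_down => rfl
  | up_up c c' h hl =>
    cases h' with
    | up_up _ c'' h' hl' => rw [h.left_unique h' hl.le hl'.le]
    | up_down _ d hc =>
      rcases h.inv_apply_eq_or_lt with h1 | h1
      · rw [h1] at hc; omega
      · omega
  | up_down c d hc h hd =>
    cases h' with
    | up_up _ c'' h' hl' =>
      rcases h'.inv_apply_eq_or_lt with h1 | h1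
      · rw [h1] at hc; omega
      · omega
    | up_down _ d' hc' h' hd' => rw [h.right_unique h' hd.le hd'.le]

namespace IsLabelledOneFace

variable {C : Type} {T : RotationSystem C} {ℓ : C → ℤ} (hT : T.IsLabelledOneFace ℓ)
include hT

theorem lab_next (c : C) : ℓ (T.next c) = ℓ (T.rev c) := hT.lab_rot _

theorem rev_eq_of_next (c : C) : T.next (T.rev c) = T.rot c := next_rev hT.rev_rev c

theorem next_inv_rot (c : C) : T.next⁻¹ (T.rot c) = T.rev c := by
  rw [Equiv.Perm.inv_eq_iff_eq, hT.rev_eq_of_next]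

theorem lab_next_inv_le (c : C) : |ℓ (T.next⁻¹ c) - ℓ c| ≤ 1 := by
  have h1 := hT.lab_rev (T.next⁻¹ c)
  rw [← hT.lab_next] at h1
  simp only [Equiv.Perm.coe_inv, Equiv.apply_symm_apply] at h1 ⊢
  rwa [abs_sub_comm]

theorem turn_left_unique {x y z : C × Bool} (h : Turn T ℓ x z) (h' : Turn T ℓ y z) : x = y := by
  -- Separates the two rules whose target is an up arc: after `T.rev c` the walk descends at once to
  -- `T.rot c`, so it cannot return to the label of `T.rev c` from above.
  have key : ∀ c c', ℓ (T.rev c) = ℓ c + 1 → ¬ (Excursion T.next ℓ (ℓ c') (T.rev c) c' ∧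
      ℓ (T.rev c) = ℓ c') := by
    rintro c c' h ⟨h1, h2⟩
    have h3 := hT.lab_next (T.rev c)
    rw [hT.rev_rev] at h3
    rcases h1.apply_eq_or_lt with h4 | h4
    · rw [h4] at h3; omega
    · omega
  -- Separates the two rules whose target is a down arc: an excursion descending to `T.rot c` passes
  -- or starts at `T.rev c`, whose label would then be `ℓ c + 1`.
  have key' : ∀ c c', ℓ (T.rev c) ≠ ℓ c + 1 → ¬ (Excursion T.next ℓ (ℓ c' - 1) c' (T.rot c) ∧
      ℓ (T.rot c) = ℓ c' - 1) := by
    rintro c c' h ⟨h1, h2⟩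
    have h0 := hT.lab_rot c
    have h3 := abs_le.1 (hT.lab_rev c)
    rcases h1.inv_apply_eq_or_lt with h4 | h4
    · rw [hT.next_inv_rot] at h4
      subst h4
      omega
    · rw [hT.next_inv_rot] at h4
      omega
  obtain ⟨z, b⟩ := z
  generalize hw : (z, b) = w at h h'
  cases h with
  | down_up c h =>
    generalize hw' : (T.rev c, false) = w' at h'
    cases h' with
    | down_up c' h' => simp at hw'; rw [hw']
    | up_up c' c'' h' hl =>
      simp at hw'
      subst hw'
      exact absurd ⟨h', hl⟩ (key c c' h)
    | _ => simp at hw'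
  | down_down c h =>
    generalize hw' : (T.rot c, true) = w' at h'
    cases h' with
    | down_down c' h' => simp at hw'; rw [hw']
    | up_down c' d hc h' hd =>
      simp at hw'
      subst hw'
      exact absurd ⟨h', hd⟩ (key' c c' h)
    | _ => simp at hw'
  | up_up c c' h hl =>
    generalize hw' : (c', false) = w' at h'
    cases h' with
    | down_up d h' =>
      simp at hw'
      subst hw'
      exact absurd ⟨h, hl⟩ (key d c h')
    | up_up d d' h' hl' =>
      simp at hw'
      subst hw'
      rw [← hl] at h
      rw [← hl'] at h'
      rw [h.right_unique h' hl.ge hl'.ge]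
    | _ => simp at hw'
  | up_down c d hc h hd =>
    generalize hw' : (d, true) = w' at h'
    cases h' with
    | down_down d' h' =>
      simp at hw'
      subst hw'
      exact absurd ⟨h, hd⟩ (key' d' c h')
    | up_down c' d' hc' h' hd' =>
      simp at hw'
      subst hw'
      -- Started one corner earlier, at label `ℓ c - 1`, the excursion has its start at its level
      -- too, so `left_unique` applies.
      have e1 : Excursion T.next ℓ (ℓ c - 1) (T.next⁻¹ c) d :=
        Excursion.of_apply (by simpa using h) (by simp)
      have e2 : Excursion T.next ℓ (ℓ c - 1) (T.next⁻¹ c') d :=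
        Excursion.of_apply (by rw [show ℓ c = ℓ c' by omega]; simpa using h') (by simp; omega)
      have := e1.left_unique e2 (by omega) (by omega)
      rw [T.next⁻¹.injective this]
    | _ => simp at hw'

/-- If the corner before `c` has label `ℓ c - 1`, this label is at least `1`, so the walk from `c`
must descend to it before reaching a corner with label `1`. Otherwise the walk backwards from `c`
meets the label `ℓ c` again, at the latest on its return to `c`. -/
theorem exists_turn [Finite C] (hmin : IsLeast (Set.range ℓ) 1) (x : C × Bool) :
    ∃ y, Turn T ℓ x y := by
  obtain ⟨c, _ | _⟩ := x
  · have hb := abs_le.1 (hT.lab_next_inv_le c)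
    by_cases hc : ℓ (T.next⁻¹ c) = ℓ c - 1
    · have h1 : 1 ≤ ℓ (T.next⁻¹ c) := hmin.2 ⟨_, rfl⟩
      obtain ⟨o, ho⟩ := hmin.1
      obtain ⟨d, h, hd⟩ := Excursion.exists_of_sameCycle (f := T.next) (ℓ := ℓ) (h := ℓ c - 1)
        (c := c) (fun x => by
          have := abs_le.1 (hT.lab_rev x)
          rw [hT.lab_next]; omega) (by left; omega) (hT.next_sameCycle c o) (by omega)
      exact ⟨_, .up_down c d hc h hd⟩
    · obtain ⟨d, h, hd⟩ := Excursion.exists_of_sameCycle (f := T.next⁻¹) (ℓ := ℓ) (h := ℓ c)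
        (c := c) (fun x => by
          have := abs_le.1 (hT.lab_next_inv_le x)
          omega) (by right; omega) (Equiv.Perm.SameCycle.refl _ c) le_rfl
      exact ⟨_, .up_up c d (by simpa using h.symm) hd⟩
  · by_cases h : ℓ (T.rev c) = ℓ c + 1
    · exact ⟨_, .down_up c h⟩
    · exact ⟨_, .down_down c h⟩

end IsLabelledOneFace

end RotationSystem

/-! ### Distance labels and the faces of a quadrangulation -/

namespace RotationSystem

/-- A bipartite map whose faces have degree four. -/
structure IsQuad {D : Type} (M : RotationSystem D) : Prop extends M.IsMap where
  bipartite : M.IsBipartite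
  next_four : ∀ d, M.next (M.next (M.next (M.next d))) = d
  next_two_ne : ∀ d, M.next (M.next d) ≠ d

section Labels

variable {D : Type} {M : RotationSystem D} {v₀ : M.Vertex}

theorem vertex_rot (d : D) : M.vertex (M.rot d) = M.vertex d :=
  Quotient.sound (s := Equiv.Perm.SameCycle.setoid M.rot)
    (⟨-1, by simp⟩ : M.rot.SameCycle (M.rot d) d)

theorem vertex_eq_iff {d d' : D} : M.vertex d = M.vertex d' ↔ M.rot.SameCycle d d' :=
  Quotient.eq (r := Equiv.Perm.SameCycle.setoid M.rot)

theorem vertex_surjective (M : RotationSystem D) : Function.Surjective M.vertex :=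
  Quotient.mk_surjective

theorem distLabel_rot (d : D) : M.distLabel v₀ (M.rot d) = M.distLabel v₀ d := by
  rw [distLabel, vertex_rot, distLabel]

theorem distLabel_pow_rot (d : D) (k : ℕ) :
    M.distLabel v₀ ((M.rot ^ k) d) = M.distLabel v₀ d := by
  induction k with
  | zero => rfl
  | succ k ih => rw [pow_succ', Equiv.Perm.mul_apply, distLabel_rot, ih]

theorem distLabel_next (d : D) : M.distLabel v₀ (M.next d) = M.distLabel v₀ (M.rev d) := by
  rw [distLabel, vertex_next, distLabel]

theorem adj_or_eq (M : RotationSystem D) (d : D) :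
    M.graph.Adj (M.vertex d) (M.vertex (M.rev d)) ∨ M.vertex d = M.vertex (M.rev d) := by
  by_cases h : M.vertex d = M.vertex (M.rev d)
  · exact .inr h
  · exact .inl ((SimpleGraph.fromRel_adj _ _ _).2 ⟨h, .inl ⟨d, rfl, rfl⟩⟩)

theorem distLabel_rev_le (hc : M.graph.Connected) (d : D) :
    M.distLabel v₀ (M.rev d) ≤ M.distLabel v₀ d + 1 := by
  rcases M.adj_or_eq d with h | h
  · have h1 := hc.dist_triangle (u := M.vertex (M.rev d)) (v := M.vertex d) (w := v₀)
    rw [SimpleGraph.dist_eq_one_iff_adj.2 h.symm] at h1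
    unfold distLabel
    omega
  · unfold distLabel
    rw [h]
    omega

theorem distLabel_eq_zero_iff (hc : M.graph.Connected) (d : D) :
    M.distLabel v₀ d = 0 ↔ M.vertex d = v₀ :=
  hc.dist_eq_zero_iff

/-- The first edge of a shortest path to `v₀`. -/
theorem exists_descending (hM : M.IsMap) (d : D) (hd : 0 < M.distLabel v₀ d) :
    ∃ d', M.rot.SameCycle d d' ∧ M.distLabel v₀ (M.rev d') + 1 = M.distLabel v₀ d := by
  obtain ⟨p, hp⟩ := hM.connected.exists_walk_length_eq_dist (M.vertex d) v₀
  change p.length = M.distLabel v₀ d at hp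
  rw [← hp] at hd ⊢
  match p, hd with
  | .cons (v := u) h p, _ =>
    have hex : ∃ d', M.vertex d' = M.vertex d ∧ M.vertex (M.rev d') = u := by
      rcases (SimpleGraph.fromRel_adj _ _ _).1 h with ⟨-, ⟨d', h1, h2⟩ | ⟨d', h1, h2⟩⟩
      · exact ⟨d', h1, h2⟩
      · exact ⟨M.rev d', h2, by rw [hM.rev_rev, h1]⟩
    obtain ⟨d', h1, h2⟩ := hex
    refine ⟨d', vertex_eq_iff.1 h1.symm, ?_⟩
    have h3 : M.distLabel v₀ (M.rev d') ≤ p.length := by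
      subst h2
      exact SimpleGraph.dist_le p
    have h4 := distLabel_rev_le (v₀ := v₀) hM.connected (M.rev d')
    rw [hM.rev_rev, distLabel, h1] at h4
    change M.distLabel v₀ d ≤ _ at h4
    rw [← hp, SimpleGraph.Walk.length_cons] at h4
    rw [SimpleGraph.Walk.length_cons]
    omega

theorem isMarked_next_iff (a : D) :
    M.IsMarked v₀ (M.next a) ↔ M.distLabel v₀ a < M.distLabel v₀ (M.next a) := by
  rw [IsMarked, Equiv.symm_apply_apply]

theorem IsMap.next_rev (hM : M.IsMap) (d : D) : M.next (M.rev d) = M.rot d :=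
  RotationSystem.next_rev hM.rev_rev d

theorem isMarked_rot_iff (hM : M.IsMap) (e : D) :
    M.IsMarked v₀ (M.rot e) ↔ M.distLabel v₀ (M.rev e) < M.distLabel v₀ e := by
  rw [← hM.next_rev, isMarked_next_iff, distLabel_next, hM.rev_rev]

theorem distLabel_next_cases (hM : M.IsMap) (hb : M.IsBipartite) (v₀ : M.Vertex) (d : D) :
    M.distLabel v₀ (M.next d) = M.distLabel v₀ d + 1 ∨
      M.distLabel v₀ d = M.distLabel v₀ (M.next d) + 1 := by
  have h1 := distLabel_next_ne hM hb v₀ d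
  have h2 := distLabel_rev_le (v₀ := v₀) hM.connected d
  have h3 := distLabel_rev_le (v₀ := v₀) hM.connected (M.rev d)
  rw [hM.rev_rev] at h3
  rw [distLabel_next] at h1 ⊢
  omega

/-- The first corner is marked when labels decrease along `e`, the second when they increase, and
bipartiteness excludes equality. This is the source of the correspondence between edges and marked
corners. -/
theorem isMarked_rot_iff_not (hM : M.IsMap) (hb : M.IsBipartite) (e : D) :
    M.IsMarked v₀ (M.rot e) ↔ ¬ M.IsMarked v₀ (M.next e) := by
  have := distLabel_next_cases hM hb v₀ e
  rw [isMarked_rot_iff hM, isMarked_next_iff, ← distLabel_next]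
  omega

section Opening

variable [Finite D]

theorem opening_rev_eq_next {d : D} (h0 : M.IsMarked v₀ d) (h1 : M.IsMarked v₀ (M.next d)) :
    (M.opening v₀).rev ⟨d, h0⟩ = ⟨M.next d, h1⟩ :=
  firstReturn_eq_of_pow one_pos (by simp) fun j h1 h2 => by omega

theorem opening_rev_eq_next_two {d : D} (h0 : M.IsMarked v₀ d) (h1 : ¬ M.IsMarked v₀ (M.next d))
    (h2 : M.IsMarked v₀ (M.next (M.next d))) :
    (M.opening v₀).rev ⟨d, h0⟩ = ⟨M.next (M.next d), h2⟩ :=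
  firstReturn_eq_of_pow two_pos rfl fun j hj1 hj2 => by
    obtain rfl : j = 1 := by omega
    simpa using h1

theorem opening_rev_eq_next_three {d : D} (h0 : M.IsMarked v₀ d)
    (h1 : ¬ M.IsMarked v₀ (M.next d)) (h2 : ¬ M.IsMarked v₀ (M.next (M.next d)))
    (h3 : M.IsMarked v₀ (M.next (M.next (M.next d)))) :
    (M.opening v₀).rev ⟨d, h0⟩ = ⟨M.next (M.next (M.next d)), h3⟩ :=
  firstReturn_eq_of_pow three_pos rfl fun j hj1 hj2 => by
    obtain rfl | rfl : j = 1 ∨ j = 2 := by omega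
    · simpa using h1
    · simpa [pow_succ] using h2

theorem opening_rot_eq {a : D} (h0 : M.IsMarked v₀ a) {k : ℕ}
    (hk : M.IsMarked v₀ ((M.rot ^ (k + 1)) a))
    (hj : ∀ j < k, ¬ M.IsMarked v₀ ((M.rot ^ (j + 1)) a)) :
    (M.opening v₀).rot ⟨a, h0⟩ = ⟨(M.rot ^ (k + 1)) a, hk⟩ :=
  firstReturn_eq_of_pow k.succ_pos rfl fun j h1 h2 => by
    obtain ⟨i, rfl⟩ : ∃ i, j = i + 1 := ⟨j - 1, by omega⟩
    exact hj i (by omega)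

theorem opening_rot_eq_rot {a : D} (h0 : M.IsMarked v₀ a) (h1 : M.IsMarked v₀ (M.rot a)) :
    (M.opening v₀).rot ⟨a, h0⟩ = ⟨M.rot a, h1⟩ :=
  opening_rot_eq h0 (k := 0) h1 (by simp)

end Opening

end Labels

/-! ### Walking around the opening of a quadrangulation -/

namespace IsQuad

variable {D : Type} {M : RotationSystem D} {v₀ : M.Vertex} (hM : M.IsQuad)
include hM

/-- Names the four labels of a face as natural numbers, so that case distinctions on the type of the
face become linear arithmetic. -/
theorem face_labels (v₀ : M.Vertex) (d : D) :
    ∃ x y z w : ℕ, M.distLabel v₀ d = x ∧ M.distLabel v₀ (M.next d) = y ∧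
      M.distLabel v₀ (M.next (M.next d)) = z ∧ M.distLabel v₀ (M.next (M.next (M.next d))) = w ∧
      (y = x + 1 ∨ x = y + 1) ∧ (z = y + 1 ∨ y = z + 1) ∧ (w = z + 1 ∨ z = w + 1) ∧
      (x = w + 1 ∨ w = x + 1) ∧
      (M.IsMarked v₀ d ↔ w < x) ∧ (M.IsMarked v₀ (M.next d) ↔ x < y) ∧
      (M.IsMarked v₀ (M.next (M.next d)) ↔ y < z) ∧
      (M.IsMarked v₀ (M.next (M.next (M.next d))) ↔ z < w) := by
  have h1 := distLabel_next_cases hM.toIsMap hM.bipartite v₀ d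
  have h2 := distLabel_next_cases hM.toIsMap hM.bipartite v₀ (M.next d)
  have h3 := distLabel_next_cases hM.toIsMap hM.bipartite v₀ (M.next (M.next d))
  have h4 := distLabel_next_cases hM.toIsMap hM.bipartite v₀ (M.next (M.next (M.next d)))
  have h5 := isMarked_next_iff (v₀ := v₀) (M.next (M.next (M.next d)))
  rw [hM.next_four] at h4 h5
  exact ⟨_, _, _, _, rfl, rfl, rfl, rfl, h1, h2, h3, h4, h5, isMarked_next_iff _,
    isMarked_next_iff _, isMarked_next_iff _⟩

theorem next_three_eq (a : D) : M.next (M.next (M.next a)) = M.next.symm a := by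
  rw [Equiv.eq_symm_apply, hM.next_four]

theorem rot_next_three (a : D) :
    M.rot (M.next (M.next (M.next a))) = M.next (M.rot.symm a) := by
  rw [next_three_eq hM, next_apply]
  congr 1
  rw [Equiv.symm_apply_eq, next_apply, hM.rev_rev, Equiv.apply_symm_apply]

variable [Finite D]

/-- As `a` is unmarked, the labels of its face are `x, x+1, z, x+1`, and its last corner rotates to
`M.next (M.rot.symm a)`. If `z = x`, the new edge joins the two corners labelled `x+1` and one step
suffices. If `z = x+2`, one step leads up to the end of the increasing arc `b = M.rev (M.next
(M.next a))` of origin label `x+1`, and `IH` for `b` leads back down. -/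
theorem excursion_up_of_unmarked {a : D} (h0 : ¬ M.IsMarked v₀ a)
    (ha : M.IsMarked v₀ (M.next a)) (ha' : M.IsMarked v₀ (M.next (M.rot.symm a)))
    (IH : ∀ (b : D) (hb : M.IsMarked v₀ (M.next b)) (hb' : M.IsMarked v₀ (M.rot (M.rot b))),
      ¬ M.IsMarked v₀ (M.rot b) → M.distLabel v₀ b = M.distLabel v₀ a + 1 →
      Excursion (M.opening v₀).next (fun d => (M.distLabel v₀ d.1 : ℤ)) (M.distLabel v₀ b)
        ⟨M.next b, hb⟩ ⟨M.rot (M.rot b), hb'⟩) :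
    Excursion (M.opening v₀).next (fun d => (M.distLabel v₀ d.1 : ℤ)) (M.distLabel v₀ a + 1)
      ⟨M.next a, ha⟩ ⟨M.next (M.rot.symm a), ha'⟩ := by
  obtain ⟨x, y, z, w, hx, hy, hz, hw, c1, c2, c3, c4, m1, m2, m3, m4⟩ := hM.face_labels v₀ a
  have n1 := mt m1.2 h0
  have n2 := m2.1 ha
  have hr3 := hM.rot_next_three a
  have m5 : M.IsMarked v₀ (M.rot (M.next (M.next (M.next a)))) := by rwa [hr3]
  by_cases hA : M.IsMarked v₀ (M.next (M.next a))
  · have n3 := m3.1 hA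
    have m6 : M.IsMarked v₀ (M.rot (M.next (M.next a))) :=
      (isMarked_rot_iff_not hM.toIsMap hM.bipartite _).2 (by rw [m4]; omega)
    have hstep : (M.opening v₀).next ⟨M.next a, ha⟩ = ⟨M.rot (M.next (M.next a)), m6⟩ := by
      rw [next_apply, opening_rev_eq_next ha hA, opening_rot_eq_rot hA m6]
    have hb1 : M.next (M.rev (M.next (M.next a))) = M.rot (M.next (M.next a)) := hM.next_rev _
    have hb2 : M.rot (M.rev (M.next (M.next a))) = M.next (M.next (M.next a)) := rfl
    have hlab : M.distLabel v₀ (M.rev (M.next (M.next a))) = w := by rw [← distLabel_next, hw]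
    have := IH (M.rev (M.next (M.next a))) (by rwa [hb1]) (by rwa [hb2]) (by rw [hb2, m4]; omega)
      (by rw [hlab]; omega)
    simp only [hb1, hb2, hr3] at this
    refine Excursion.of_apply ?_ ?_
    · rw [hstep]
      exact this.mono (by omega)
    · rw [hstep]
      change _ < (M.distLabel v₀ (M.rot _) : ℤ)
      rw [distLabel_rot]
      omega
  · have n3 := mt m3.2 hA
    have hB : M.IsMarked v₀ (M.next (M.next (M.next a))) := by rw [m4]; omega
    have hstep : (M.opening v₀).next ⟨M.next a, ha⟩ = ⟨M.next (M.rot.symm a), ha'⟩ := by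
      rw [next_apply, opening_rev_eq_next_two ha hA hB, opening_rot_eq_rot hB m5]
      exact Subtype.ext hr3
    rw [← hstep]
    exact Excursion.single _ _ _ _

/-- The labels of the face are `x, x+1, x, x-1`, so `a` and `M.next a` are its only marked corners
and the new edge joins them. -/
theorem opening_next_of_marked {a : D} (h0 : M.IsMarked v₀ a) (ha : M.IsMarked v₀ (M.next a)) :
    (M.opening v₀).next ⟨M.next a, ha⟩ = (M.opening v₀).rot ⟨a, h0⟩ := by
  obtain ⟨x, y, z, w, hx, hy, hz, hw, c1, c2, c3, c4, m1, m2, m3, m4⟩ := hM.face_labels v₀ a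
  have n1 := m1.1 h0
  have n2 := m2.1 ha
  rw [next_apply, opening_rev_eq_next_three ha (by rw [m3]; omega) (by rw [m4]; omega)
    (by rwa [hM.next_four])]
  simp only [hM.next_four]

/-- The corner after an increasing arc is followed, around the opening, by the corner of the first
decreasing arc at its origin. -/
theorem excursion_down_of_up (i : ℕ)
    (hup : ∀ (a : D) (ha : M.IsMarked v₀ (M.next a)) (ha' : M.IsMarked v₀ (M.next (M.rot.symm a))),
      ¬ M.IsMarked v₀ a → M.distLabel v₀ a = i →
      Excursion (M.opening v₀).next (fun d => (M.distLabel v₀ d.1 : ℤ)) (M.distLabel v₀ a + 1)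
        ⟨M.next a, ha⟩ ⟨M.next (M.rot.symm a), ha'⟩)
    (a : D) (k : ℕ) (ha : M.IsMarked v₀ (M.next a)) (hk : M.IsMarked v₀ ((M.rot ^ (k + 1)) a))
    (hj : ∀ j < k, ¬ M.IsMarked v₀ ((M.rot ^ (j + 1)) a)) (hi : M.distLabel v₀ a = i) :
    Excursion (M.opening v₀).next (fun d => (M.distLabel v₀ d.1 : ℤ)) (M.distLabel v₀ a)
      ⟨M.next a, ha⟩ ⟨(M.rot ^ (k + 1)) a, hk⟩ := by
  have base : ∀ (a : D) (k : ℕ) (ha : M.IsMarked v₀ (M.next a))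
      (hk : M.IsMarked v₀ ((M.rot ^ (k + 1)) a))
      (_ : ∀ j < k, ¬ M.IsMarked v₀ ((M.rot ^ (j + 1)) a)) (_ : M.IsMarked v₀ a),
      Excursion (M.opening v₀).next (fun d => (M.distLabel v₀ d.1 : ℤ)) (M.distLabel v₀ a)
        ⟨M.next a, ha⟩ ⟨(M.rot ^ (k + 1)) a, hk⟩ := by
    intro a k ha hk hj h0
    rw [← opening_rot_eq h0 hk hj, ← hM.opening_next_of_marked h0 ha]
    exact Excursion.single _ _ _ _
  -- The induction turns clockwise around the origin of `a` until a marked corner is met. There is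
  -- one, since the corner `(M.rot ^ (k + 1)) a` is marked.
  have hs : ∃ n : ℕ, M.IsMarked v₀ ((M.rot⁻¹ ^ n) a) := by
    have h1 : M.rot⁻¹.SameCycle a ((M.rot ^ (k + 1)) a) :=
      Equiv.Perm.sameCycle_inv.2 ⟨(k + 1 : ℕ), by rw [zpow_natCast]⟩
    obtain ⟨n, hn⟩ := h1.exists_nat_pow_eq
    exact ⟨n, by rwa [hn]⟩
  obtain ⟨n, hn⟩ := hs
  induction n generalizing a k with
  | zero => exact base a k ha hk hj hn
  | succ n ih =>
    by_cases h0 : M.IsMarked v₀ a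
    · exact base a k ha hk hj h0
    · have ha' : M.IsMarked v₀ (M.next (M.rot.symm a)) := by
        by_contra hc
        rw [← isMarked_rot_iff_not hM.toIsMap hM.bipartite, Equiv.apply_symm_apply] at hc
        exact h0 hc
      have hl : M.distLabel v₀ (M.rot.symm a) = M.distLabel v₀ a := by
        rw [← distLabel_rot, Equiv.apply_symm_apply]
      have hpow : ∀ j, (M.rot ^ (j + 1)) (M.rot.symm a) = (M.rot ^ j) a := fun j => by
        rw [pow_succ, Equiv.Perm.mul_apply, Equiv.apply_symm_apply]
      -- `h1` leads to the corner at the end of the preceding increasing arc `M.rot.symm a`; `h2`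
      -- continues from there, with one more unmarked corner, that of `a`, before the same target.
      have h1 := hup a ha ha' h0 hi
      have h2 := ih (M.rot.symm a) (k + 1) ha' (by rwa [hpow]) (fun j hj' => by
        rw [hpow]
        cases j with
        | zero => simpa using h0
        | succ j => exact hj j (by omega)) (by rw [hl, hi]) (by
        rw [pow_succ, Equiv.Perm.mul_apply] at hn
        exact hn)
      simp only [hpow, hl] at h2
      refine (h1.mono (by omega)).trans ?_ h2
      have h3 := (isMarked_next_iff _).1 ha'
      change (_ : ℤ) < (M.distLabel v₀ (M.next (M.rot.symm a)) : ℤ)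
      omega

/-- Induction downwards from the largest label: `excursion_up_of_unmarked` needs
`excursion_down_of_up` one label higher, which needs only the present statement at that higher
label. -/
theorem excursion_up (a : D) (ha : M.IsMarked v₀ (M.next a))
    (ha' : M.IsMarked v₀ (M.next (M.rot.symm a))) (h0 : ¬ M.IsMarked v₀ a) :
    Excursion (M.opening v₀).next (fun d => (M.distLabel v₀ d.1 : ℤ)) (M.distLabel v₀ a + 1)
      ⟨M.next a, ha⟩ ⟨M.next (M.rot.symm a), ha'⟩ := by
  obtain ⟨N, hN⟩ : ∃ N, ∀ d, M.distLabel v₀ d ≤ N := by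
    obtain ⟨N, hN⟩ := (Set.finite_range (M.distLabel v₀)).bddAbove
    exact ⟨N, fun d => hN ⟨d, rfl⟩⟩
  obtain ⟨m, hm⟩ : ∃ m, N < M.distLabel v₀ a + m := ⟨N + 1, by omega⟩
  induction m generalizing a with
  | zero => have := hN a; omega
  | succ m ih =>
    refine hM.excursion_up_of_unmarked h0 ha ha' fun b hb hb' hb1 hlb => ?_
    exact hM.excursion_down_of_up (M.distLabel v₀ b)
      (fun c hc hc' hc0 hlc => ih c hc hc' hc0 (by omega)) b 1 hb
      (by simpa [pow_succ] using hb') (fun j hj => by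
        obtain rfl : j = 0 := by omega
        simpa using hb1) rfl

theorem excursion_down (a : D) (k : ℕ) (ha : M.IsMarked v₀ (M.next a))
    (hk : M.IsMarked v₀ ((M.rot ^ (k + 1)) a))
    (hj : ∀ j < k, ¬ M.IsMarked v₀ ((M.rot ^ (j + 1)) a)) :
    Excursion (M.opening v₀).next (fun d => (M.distLabel v₀ d.1 : ℤ)) (M.distLabel v₀ a)
      ⟨M.next a, ha⟩ ⟨(M.rot ^ (k + 1)) a, hk⟩ :=
  hM.excursion_down_of_up _ (fun b hb hb' h0 _ => hM.excursion_up b hb hb' h0) a k ha hk hj rfl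

end IsQuad

end RotationSystem

/-! ### The opening is a labelled one-face map -/

namespace RotationSystem

namespace IsQuad

variable {D : Type} {M : RotationSystem D} {v₀ : M.Vertex} (hM : M.IsQuad)
include hM

theorem isMarked_next_of_distLabel_eq_zero {a : D} (ha : M.distLabel v₀ a = 0) :
    M.IsMarked v₀ (M.next a) := by
  have := distLabel_next_cases hM.toIsMap hM.bipartite v₀ a
  rw [isMarked_next_iff]
  omega

variable [Finite D]

theorem exists_first_marked {a : D} (ha : 0 < M.distLabel v₀ a) :
    ∃ k, M.IsMarked v₀ ((M.rot ^ (k + 1)) a) ∧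
      ∀ j < k, ¬ M.IsMarked v₀ ((M.rot ^ (j + 1)) a) := by
  classical
  have hex : ∃ k, M.IsMarked v₀ ((M.rot ^ (k + 1)) a) := by
    obtain ⟨d, hd, hl⟩ := exists_descending hM.toIsMap a ha
    obtain ⟨k, hk⟩ := hd.exists_nat_pow_eq
    have hda : M.distLabel v₀ a = M.distLabel v₀ d := by
      unfold distLabel
      rw [vertex_eq_iff.2 hd]
    refine ⟨k, ?_⟩
    rw [pow_succ', Equiv.Perm.mul_apply, hk, isMarked_rot_iff hM.toIsMap]
    omega
  exact ⟨Nat.find hex, Nat.find_spec hex, fun j hj => Nat.find_min hex hj⟩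

/-- Each use of `excursion_down` lowers the label by one. -/
theorem exists_sameCycle_distLabel_one (n : ℕ) (c : {d // M.IsMarked v₀ d})
    (hc : M.distLabel v₀ c.1 = n + 1) :
    ∃ c', (M.opening v₀).next.SameCycle c c' ∧ M.distLabel v₀ c'.1 = 1 := by
  induction n generalizing c with
  | zero => exact ⟨c, Equiv.Perm.SameCycle.refl _ _, hc⟩
  | succ n ih =>
    obtain ⟨c, hm⟩ := c
    obtain ⟨a, rfl⟩ := M.next.surjective c
    have h1 := (isMarked_next_iff a).1 hm
    have h2 := distLabel_next_cases hM.toIsMap hM.bipartite v₀ a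
    simp only at hc
    obtain ⟨k, hk, hj⟩ := hM.exists_first_marked (v₀ := v₀) (a := a) (by omega)
    have h3 := (hM.excursion_down a k hm hk hj).sameCycle
    obtain ⟨c', hc', hl⟩ := ih ⟨_, hk⟩ (by rw [distLabel_pow_rot]; omega)
    exact ⟨c', h3.trans hc', hl⟩

/-- The opening has one face: any walk descends to label `1`, and the marked corners with label `1`
are at the ends of the arcs leaving `v₀`. These arcs all increase, so consecutive ones are linked by
`excursion_up`. -/
theorem opening_next_sameCycle (c d : {d // M.IsMarked v₀ d}) :
    (M.opening v₀).next.SameCycle c d := by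
  have pos : ∀ c : {d // M.IsMarked v₀ d}, 0 < M.distLabel v₀ c.1 := fun c =>
    lt_of_le_of_lt (Nat.zero_le _) c.2
  obtain ⟨c', hc, hc1⟩ := hM.exists_sameCycle_distLabel_one (M.distLabel v₀ c.1 - 1) c
    (by have := pos c; omega)
  obtain ⟨d', hd, hd1⟩ := hM.exists_sameCycle_distLabel_one (M.distLabel v₀ d.1 - 1) d
    (by have := pos d; omega)
  refine hc.trans (Equiv.Perm.SameCycle.trans ?_ hd.symm)
  obtain ⟨c', hm⟩ := c'
  obtain ⟨d', hm'⟩ := d'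
  obtain ⟨a, rfl⟩ := M.next.surjective c'
  obtain ⟨b, rfl⟩ := M.next.surjective d'
  have ha := (isMarked_next_iff a).1 hm
  have hb := (isMarked_next_iff b).1 hm'
  simp only at hc1 hd1
  have ha0 : M.distLabel v₀ a = 0 := by omega
  have hv : M.rot.SameCycle b a := vertex_eq_iff.1 (((distLabel_eq_zero_iff hM.connected b).1
    (by omega)).trans ((distLabel_eq_zero_iff hM.connected a).1 ha0).symm)
  obtain ⟨n, rfl⟩ := hv.exists_nat_pow_eq
  clear hc hc1 ha hv
  induction n with
  | zero => exact Equiv.Perm.SameCycle.refl _ _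
  | succ n ih =>
    have hn : M.distLabel v₀ ((M.rot ^ n) b) = 0 := by
      rwa [distLabel_pow_rot] at ha0 ⊢
    have hs : M.rot.symm ((M.rot ^ (n + 1)) b) = (M.rot ^ n) b := by
      rw [pow_succ', Equiv.Perm.mul_apply, Equiv.symm_apply_apply]
    have hmn := hM.isMarked_next_of_distLabel_eq_zero hn
    refine Equiv.Perm.SameCycle.trans ?_ (ih hmn hn)
    have := hM.excursion_up ((M.rot ^ (n + 1)) b) hm (by rwa [hs]) (by
      rw [IsMarked]; omega)
    simp only [hs] at this
    exact this.sameCycle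

theorem opening_rev_cases (d : {d // M.IsMarked v₀ d}) :
    (M.IsMarked v₀ (M.next d.1) ∧ ((M.opening v₀).rev d).1 = M.next d.1 ∧
      M.distLabel v₀ ((M.opening v₀).rev d).1 = M.distLabel v₀ d.1 + 1) ∨
    (¬ M.IsMarked v₀ (M.next d.1) ∧ ((M.opening v₀).rev d).1 = M.next (M.next d.1) ∧
      M.distLabel v₀ ((M.opening v₀).rev d).1 = M.distLabel v₀ d.1) ∨
    ((¬ M.IsMarked v₀ (M.next d.1) ∧ ¬ M.IsMarked v₀ (M.next (M.next d.1))) ∧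
      ((M.opening v₀).rev d).1 = M.next (M.next (M.next d.1)) ∧
      M.distLabel v₀ ((M.opening v₀).rev d).1 + 1 = M.distLabel v₀ d.1) := by
  obtain ⟨d, h0⟩ := d
  obtain ⟨x, y, z, w, hx, hy, hz, hw, c1, c2, c3, c4, m1, m2, m3, m4⟩ := hM.face_labels v₀ d
  have n1 := m1.1 h0
  by_cases h1 : M.IsMarked v₀ (M.next d)
  · have n2 := m2.1 h1
    refine .inl ⟨h1, ?_⟩
    rw [opening_rev_eq_next h0 h1]
    exact ⟨rfl, by simp only; omega⟩
  · have n2 := mt m2.2 h1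
    by_cases h2 : M.IsMarked v₀ (M.next (M.next d))
    · have n3 := m3.1 h2
      refine .inr (.inl ⟨h1, ?_⟩)
      rw [opening_rev_eq_next_two h0 h1 h2]
      exact ⟨rfl, by simp only; omega⟩
    · have n3 := mt m3.2 h2
      refine .inr (.inr ⟨⟨h1, h2⟩, ?_⟩)
      rw [opening_rev_eq_next_three h0 h1 h2 (m4.2 (by omega))]
      exact ⟨rfl, by simp only; omega⟩

/-- The numbers of steps to the other marked corner and back add up to four: `1 + 3`, `2 + 2` or `3
+ 1`. -/
theorem opening_rev_rev (d : {d // M.IsMarked v₀ d}) :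
    (M.opening v₀).rev ((M.opening v₀).rev d) = d := by
  have h := hM.opening_rev_cases d
  have h' := hM.opening_rev_cases ((M.opening v₀).rev d)
  apply Subtype.ext
  have h4 := hM.next_four
  obtain ⟨x, y, z, w, hx, hy, hz, hw, c1, c2, c3, c4, m1, m2, m3, m4⟩ := hM.face_labels v₀ d.1
  have n1 := m1.1 d.2
  rcases h with ⟨h0, h1, h2⟩ | ⟨h0, h1, h2⟩ | ⟨h0, h1, h2⟩ <;> rw [h1] at h' h2 <;>
    simp only [h4, m1, m2, m3, m4] at h' h0 <;>
    rcases h' with ⟨g0, g1, g2⟩ | ⟨g0, g1, g2⟩ | ⟨g0, g1, g2⟩ <;> rw [g1] at g2 ⊢ <;>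
    first | rfl | omega

theorem opening_isLabelledOneFace :
    (M.opening v₀).IsLabelledOneFace (fun d => (M.distLabel v₀ d.1 : ℤ)) where
  rev_rev := hM.opening_rev_rev
  rev_ne d h := by
    obtain ⟨x, y, z, w, hx, hy, hz, hw, c1, c2, c3, c4, m1, m2, m3, m4⟩ := hM.face_labels v₀ d.1
    have n1 := m1.1 d.2
    rcases hM.opening_rev_cases d with ⟨h0, h1, h2⟩ | ⟨h0, h1, h2⟩ | ⟨h0, h1, h2⟩
    · rw [h] at h2; omega
    · rw [h] at h1
      exact hM.next_two_ne _ h1.symm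
    · rw [h] at h2; omega
  next_sameCycle := hM.opening_next_sameCycle
  lab_rot d := by
    obtain ⟨k, -, hk, -⟩ := exists_pow_firstReturn M.rot (M.IsMarked v₀) d
    change (M.distLabel v₀ (firstReturn M.rot (M.IsMarked v₀) d).1 : ℤ) = _
    rw [← hk, distLabel_pow_rot]
  lab_rev d := by
    rw [abs_le]
    rcases hM.opening_rev_cases d with h | h | h <;> omega

/-! ### The arcs of a quadrangulation -/

omit [Finite D] in
open Classical in
/-- Each edge of the quadrangulation leads from a marked corner to a vertex with smaller label. -/
noncomputable def arcEquiv (hM : M.IsQuad) (v₀ : M.Vertex) :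
    {d // M.IsMarked v₀ d} × Bool ≃ D where
  toFun x := if x.2 then M.rot.symm x.1.1 else M.next.symm x.1.1
  invFun d := if h : M.IsMarked v₀ (M.rot d) then (⟨M.rot d, h⟩, true) else
    (⟨M.next d, by rwa [isMarked_rot_iff_not hM.toIsMap hM.bipartite, not_not] at h⟩, false)
  left_inv := by
    rintro ⟨⟨c, hc⟩, _ | _⟩
    · have : ¬ M.IsMarked v₀ (M.rot (M.next.symm c)) := by
        rw [isMarked_rot_iff_not hM.toIsMap hM.bipartite, not_not]
        simpa using hc
      simp [this]
    · simp [hc]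
  right_inv d := by
    by_cases h : M.IsMarked v₀ (M.rot d) <;> simp [h]

omit [Finite D] in
theorem arcEquiv_true (c : {d // M.IsMarked v₀ d}) :
    hM.arcEquiv v₀ (c, true) = M.rot.symm c.1 := rfl

omit [Finite D] in
theorem arcEquiv_false (c : {d // M.IsMarked v₀ d}) :
    hM.arcEquiv v₀ (c, false) = M.next.symm c.1 := rfl

omit [Finite D] in
theorem arcEquiv_not (x : {d // M.IsMarked v₀ d} × Bool) :
    hM.arcEquiv v₀ (x.1, !x.2) = M.rev (hM.arcEquiv v₀ x) := by
  have key : ∀ c, M.next.symm c = M.rev (M.rot.symm c) := fun c => by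
    rw [Equiv.symm_apply_eq, hM.next_rev, Equiv.apply_symm_apply]
  obtain ⟨c, _ | _⟩ := x
  · rw [Bool.not_false, arcEquiv_true, arcEquiv_false, key, hM.rev_rev]
  · rw [Bool.not_true, arcEquiv_true, arcEquiv_false, key]

/-- The rotation of the quadrangulation can be read off its labelled opening. Two consecutive
increasing arcs are the case of `excursion_up`, an increasing arc followed by a decreasing one that
of `excursion_down`; after a decreasing arc, the opening needs a single step of `rev` or of `rot`.
-/
theorem turn_arcEquiv {x y : {d // M.IsMarked v₀ d} × Bool}
    (h : M.rot (hM.arcEquiv v₀ x) = hM.arcEquiv v₀ y) :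
    Turn (M.opening v₀) (fun d => (M.distLabel v₀ d.1 : ℤ)) x y := by
  obtain ⟨⟨c, hc⟩, _ | _⟩ := x <;> obtain ⟨⟨c', hc'⟩, _ | _⟩ := y
  · obtain ⟨a, rfl⟩ := M.next.surjective c
    simp only [arcEquiv_false, Equiv.symm_apply_apply, Equiv.eq_symm_apply] at h
    subst h
    have h1 := (isMarked_next_iff _).1 hc
    have h2 := distLabel_next_cases hM.toIsMap hM.bipartite v₀ a
    have h3 := (isMarked_next_iff _).1 hc'
    have h4 := distLabel_next_cases hM.toIsMap hM.bipartite v₀ (M.rot a)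
    have h5 : ¬ M.IsMarked v₀ (M.rot a) := by
      rwa [isMarked_rot_iff_not hM.toIsMap hM.bipartite, not_not]
    rw [distLabel_rot] at h3 h4
    have := hM.excursion_up (M.rot a) hc' (by simpa using hc) h5
    simp only [Equiv.symm_apply_apply, distLabel_rot] at this
    refine .up_up _ _ (this.mono ?_) ?_
    · simp only; omega
    · simp only; omega
  · obtain ⟨a, rfl⟩ := M.next.surjective c
    simp only [arcEquiv_false, arcEquiv_true, Equiv.symm_apply_apply, Equiv.eq_symm_apply] at h
    subst h
    have h1 := (isMarked_next_iff _).1 hc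
    have h2 := distLabel_next_cases hM.toIsMap hM.bipartite v₀ a
    have h5 : ¬ M.IsMarked v₀ (M.rot a) := by
      rwa [isMarked_rot_iff_not hM.toIsMap hM.bipartite, not_not]
    have := hM.excursion_down a 1 hc (by simpa [pow_succ] using hc') (fun j hj => by
      obtain rfl : j = 0 := by omega
      simpa using h5)
    have hl : (M.distLabel v₀ (M.next a) : ℤ) - 1 = M.distLabel v₀ a := by omega
    refine .up_down _ _ ?_ ?_ ?_
    -- With `i` the label of `a`, the face between the two arcs has labels `i+1, i, i-1, i` from
    -- `M.rev a` on. The walk around the opening goes from its last corner, labelled `i`, directly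
    -- to `M.next a`.
    · obtain ⟨x, y, z, w, hx, hy, hz, hw, c1, c2, c3, c4, m1, m2, m3, m4⟩ :=
        hM.face_labels v₀ (M.rev a)
      rw [hM.next_rev] at hy hz hw m2 m3 m4
      rw [distLabel_rot] at hy
      rw [← distLabel_next] at hx
      have n3 := mt m3.2 ((isMarked_rot_iff_not hM.toIsMap hM.bipartite _).1 hc')
      have hm : M.IsMarked v₀ (M.next (M.next (M.rot a))) := m4.2 (by omega)
      have h4 : M.next (M.next (M.next (M.rot a))) = M.rev a := by
        rw [← hM.next_rev, hM.next_four]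
      have hm' : M.IsMarked v₀ (M.rev a) := m1.2 (by omega)
      have hn : (M.opening v₀).next ⟨_, hm⟩ = ⟨M.next a, hc⟩ := by
        rw [next_apply, opening_rev_eq_next hm (by rwa [h4])]
        simp only [h4]
        exact opening_rot_eq_rot hm' hc
      rw [← hn, Equiv.Perm.coe_inv, Equiv.symm_apply_apply]
      simp only [hn]
      omega
    · simp only [hl]
      simpa [pow_succ] using this
    · simp only [hl, distLabel_rot]
  · simp only [arcEquiv_false, arcEquiv_true, Equiv.apply_symm_apply, Equiv.eq_symm_apply] at h
    subst h
    rw [← opening_rev_eq_next hc hc']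
    refine .down_up _ ?_
    rw [opening_rev_eq_next hc hc']
    have h1 := (isMarked_next_iff _).1 hc'
    have h2 := distLabel_next_cases hM.toIsMap hM.bipartite v₀ c
    simp only
    omega
  · simp only [arcEquiv_true, Equiv.apply_symm_apply, Equiv.eq_symm_apply] at h
    subst h
    rw [← opening_rot_eq_rot hc hc']
    refine .down_down _ ?_
    have hn := (isMarked_rot_iff_not hM.toIsMap hM.bipartite _).1 hc'
    rcases hM.opening_rev_cases ⟨c, hc⟩ with h | h | h
    · exact absurd h.1 hn
    · intro h'
      simp only at h h'
      omega
    · intro h'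
      simp only at h h'
      omega

end IsQuad

end RotationSystem

/-! ### Counting vertices, edges and faces -/

theorem natCard_quotient_firstReturn {D : Type} [Finite D] (f : Equiv.Perm D) (p : D → Prop) :
    Nat.card (Quotient (Equiv.Perm.SameCycle.setoid (firstReturn f p)))
      = Nat.card {q : Quotient (Equiv.Perm.SameCycle.setoid f) // ∃ d, p d ∧ Quotient.mk _ d = q} := by
  refine Nat.card_congr (Equiv.ofBijective (Quotient.lift
    (fun d => ⟨Quotient.mk _ d.1, d.1, d.2, rfl⟩) fun x y h => ?_) ⟨?_, ?_⟩)
  · exact Subtype.ext (Quotient.sound ((sameCycle_firstReturn f p x y).1 h))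
  · intro x y
    refine Quotient.inductionOn₂ x y fun x y h => ?_
    exact Quotient.sound ((sameCycle_firstReturn f p x y).2
      (Quotient.exact (congrArg Subtype.val h)))
  · rintro ⟨_, d, hd, rfl⟩
    exact ⟨Quotient.mk _ ⟨d, hd⟩, rfl⟩

theorem natCard_quotient_of_conj {D D' : Type} {f : Equiv.Perm D} {f' : Equiv.Perm D'} (e : D ≃ D')
    (he : ∀ d, e (f d) = f' (e d)) :
    Nat.card (Quotient (Equiv.Perm.SameCycle.setoid f))
      = Nat.card (Quotient (Equiv.Perm.SameCycle.setoid f')) :=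
  Nat.card_congr (Quotient.congr e fun x y => sameCycle_iff_of_conj e he x y)

namespace RotationSystem

section Count

variable {D : Type} [Finite D] {M : RotationSystem D} {v₀ : M.Vertex}

theorem natCard_eq_two_mul_edge (h : ∀ d, M.rev (M.rev d) = d) (h' : ∀ d, M.rev d ≠ d) :
    Nat.card D = 2 * Nat.card M.Edge :=
  natCard_eq_mul_of_minimalPeriod _ _ fun d => by
    have h1 : Function.IsPeriodicPt M.rev 2 d := h d
    exact Function.minimalPeriod_eq_prime h1 (h' d)

theorem natCard_eq_four_mul_face (h : ∀ f, M.faceDegree f = 4) :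
    Nat.card D = 4 * Nat.card M.Face :=
  natCard_eq_mul_of_minimalPeriod _ _ fun d => by
    rw [← natCard_mk_eq]
    exact h (M.face d)

theorem IsBipartiteQuadrangulation.isQuad {g n : ℕ} (hM : M.IsBipartiteQuadrangulation g n) :
    M.IsQuad where
  toIsMap := hM.toIsMap
  bipartite := hM.bipartite
  next_four d := by
    have h : Function.minimalPeriod M.next d = 4 := by
      rw [← natCard_mk_eq]
      exact hM.degree_eq_four (M.face d)
    have h1 := Function.iterate_minimalPeriod (f := M.next) (x := d)
    rwa [h] at h1
  next_two_ne d h2 := by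
    have h : Function.minimalPeriod M.next d = 4 := by
      rw [← natCard_mk_eq]
      exact hM.degree_eq_four (M.face d)
    have h1 : Function.IsPeriodicPt M.next 2 d := h2
    have := h1.minimalPeriod_le two_pos
    omega

theorem IsQuad.faceDegree_eq (hM : M.IsQuad) (f : M.Face) : M.faceDegree f = 4 := by
  induction f using Quotient.inductionOn with
  | h d =>
    change Nat.card {x // _} = 4
    refine (natCard_mk_eq M.next d).trans ?_
    have h1 : Function.IsPeriodicPt M.next (2 ^ (1 + 1)) d := hM.next_four d
    exact Function.minimalPeriod_eq_prime_pow (p := 2) (k := 1) (hM.next_two_ne d) h1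

theorem natCard_opening_edge (hM : M.IsMap) (hb : M.IsBipartite) :
    Nat.card (M.opening v₀).Edge = Nat.card M.Face := by
  refine (natCard_quotient_firstReturn M.next (M.IsMarked v₀)).trans ?_
  refine Nat.card_congr (Equiv.subtypeUnivEquiv fun q => ?_)
  induction q using Quotient.inductionOn with
  | h d =>
    obtain ⟨k, hk⟩ := exists_marked hM hb v₀ d
    exact ⟨_, hk, Quotient.sound (Equiv.Perm.SameCycle.symm ⟨k, by rw [zpow_natCast]⟩)⟩

/-- A vertex survives when an arc leads from it to a smaller label; only `v₀` has none. -/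
theorem IsQuad.natCard_opening_vertex (hM : M.IsQuad) :
    Nat.card (M.opening v₀).Vertex + 1 = Nat.card M.Vertex := by
  classical
  have h1 : Nat.card (M.opening v₀).Vertex = Nat.card {q : M.Vertex // q ≠ v₀} := by
    refine (natCard_quotient_firstReturn M.rot (M.IsMarked v₀)).trans ?_
    refine Nat.card_congr (Equiv.subtypeEquivRight fun q => ?_)
    constructor
    · rintro ⟨d, hd, rfl⟩ h
      have h0 := (distLabel_eq_zero_iff hM.connected d).2 h
      rw [IsMarked] at hd
      omega
    · intro hq
      obtain ⟨d, rfl⟩ := M.vertex_surjective q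
      have h0 : 0 < M.distLabel v₀ d := by
        rw [Nat.pos_iff_ne_zero, Ne, distLabel_eq_zero_iff hM.connected]
        exact hq
      obtain ⟨k, hk, -⟩ := hM.exists_first_marked h0
      exact ⟨_, hk, Quotient.sound
        (Equiv.Perm.SameCycle.symm ⟨(k + 1 : ℕ), by rw [zpow_natCast]⟩)⟩
  rw [h1, ← Finite.card_option, Nat.card_congr (Equiv.optionSubtypeNe v₀)]

omit [Finite D] in
theorem connected_of_next_sameCycle [Nonempty D] (h : ∀ c d, M.next.SameCycle c d) :
    M.graph.Connected := by
  have step : ∀ d, M.graph.Reachable (M.vertex d) (M.vertex (M.next d)) := fun d => by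
    rw [vertex_next]
    rcases M.adj_or_eq d with h | h
    · exact h.reachable
    · rw [h]
  obtain ⟨o⟩ := ‹Nonempty D›
  have hz : ∀ (n : ℤ), M.graph.Reachable (M.vertex o) (M.vertex ((M.next ^ n) o)) := by
    intro n
    induction n using Int.induction_on with
    | zero => exact SimpleGraph.Reachable.refl _
    | succ n ih =>
      rw [add_comm, zpow_add, zpow_one]
      exact ih.trans (step _)
    | pred n ih =>
      refine ih.trans (SimpleGraph.Reachable.symm ?_)
      have := step ((M.next ^ (-(n : ℤ) - 1)) o)
      rwa [← Equiv.Perm.mul_apply, ← zpow_one_add, add_sub_cancel] at this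
  have hall : ∀ v, M.graph.Reachable (M.vertex o) v := fun v => by
    obtain ⟨d, rfl⟩ := M.vertex_surjective v
    obtain ⟨n, rfl⟩ := h o d
    exact hz n
  exact { preconnected := fun u v => (hall u).symm.trans (hall v), nonempty := ⟨M.vertex o⟩ }

omit [Finite D] in
theorem natCard_face_eq_one_iff [Nonempty D] :
    Nat.card M.Face = 1 ↔ ∀ c d, M.next.SameCycle c d := by
  rw [Nat.card_eq_one_iff_unique]
  constructor
  · rintro ⟨h, -⟩ c d
    exact Quotient.exact (s := Equiv.Perm.SameCycle.setoid M.next)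
      (Subsingleton.elim (M.face c) (M.face d))
  · intro h
    refine ⟨⟨fun x y => ?_⟩, ‹Nonempty D›.map M.face⟩
    induction x, y using Quotient.inductionOn₂ with
    | h c d => exact Quotient.sound (h c d)

/-- `h3` and `h4` give `E = 2F`, so Euler's formula reads `V - F = 2 - 2g`. The opening has `V - 1`
vertices, `F` edges and one face, with the same characteristic. -/
theorem IsQuad.opening_isGTree (hM : M.IsQuad) [Nonempty {d // M.IsMarked v₀ d}] {g n : ℕ}
    (he : (Nat.card M.Vertex : ℤ) - Nat.card M.Edge + Nat.card M.Face = 2 - 2 * g)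
    (hn : Nat.card M.Face = n) : (M.opening v₀).IsGTree g n := by
  have hT := hM.opening_isLabelledOneFace (v₀ := v₀)
  have h1 := natCard_opening_edge (v₀ := v₀) hM.toIsMap hM.bipartite
  have h2 := hM.natCard_opening_vertex (v₀ := v₀)
  have h3 := natCard_eq_two_mul_edge hM.rev_rev hM.rev_ne
  have h4 := natCard_eq_four_mul_face hM.faceDegree_eq
  have h5 := natCard_face_eq_one_iff.2 hT.next_sameCycle
  exact { rev_rev := hT.rev_rev
          rev_ne := hT.rev_ne
          connected := connected_of_next_sameCycle hT.next_sameCycle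
          euler := by omega
          card_face := h5
          card_edge := by omega }

theorem IsQuad.isBipartiteQuadrangulation (hM : M.IsQuad) {C : Type}
    {T : RotationSystem C} {g n : ℕ} (hT : T.IsGTree g n) {e : C ≃ {d // M.IsMarked v₀ d}}
    (he : T.Carries (M.opening v₀) e) : M.IsBipartiteQuadrangulation g n := by
  have h1 := natCard_opening_edge (v₀ := v₀) hM.toIsMap hM.bipartite
  have h2 := hM.natCard_opening_vertex (v₀ := v₀)
  have h3 := natCard_eq_two_mul_edge hM.rev_rev hM.rev_ne
  have h4 := natCard_eq_four_mul_face hM.faceDegree_eq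
  have h5 : Nat.card T.Vertex = Nat.card (M.opening v₀).Vertex := natCard_quotient_of_conj e he.1
  have h6 : Nat.card T.Edge = Nat.card (M.opening v₀).Edge := natCard_quotient_of_conj e he.2
  have h7 := hT.card_edge
  have h8 := hT.card_face
  have h9 := hT.euler
  exact { toIsMap := hM.toIsMap
          euler := by omega
          bipartite := hM.bipartite
          degree_eq_four := hM.faceDegree_eq
          card_face := by omega }

end Count

/-! ### Distance labels are determined by their local properties -/

section Distance

variable {D : Type} [Finite D] {M : RotationSystem D} {v₀ : M.Vertex}

/-- Following descending arcs gives a walk of length at most `ℓ d` to `v₀`, and a walk cannot be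
shorter because `ℓ` changes by at most one along an edge. Connectedness is part of the conclusion,
so that the closure can be treated before it is known to be a map. -/
theorem connected_and_distLabel_eq (ℓ : D → ℕ) (hrr : ∀ d, M.rev (M.rev d) = d)
    (hrot : ∀ d, ℓ (M.rot d) = ℓ d) (hrev : ∀ d, ℓ (M.rev d) ≤ ℓ d + 1)
    (h0 : ∀ d, ℓ d = 0 ↔ M.vertex d = v₀)
    (hdesc : ∀ d, 0 < ℓ d → ∃ d', M.rot.SameCycle d d' ∧ ℓ (M.rev d') + 1 = ℓ d) :
    M.graph.Connected ∧ ∀ d, M.distLabel v₀ d = ℓ d := by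
  have hlab : ∀ d d', M.vertex d = M.vertex d' → ℓ d = ℓ d' := by
    intro d d' h
    obtain ⟨n, rfl⟩ := (vertex_eq_iff.1 h).exists_nat_pow_eq
    clear h
    induction n with
    | zero => rfl
    | succ n ih => rw [pow_succ', Equiv.Perm.mul_apply, hrot, ← ih]
  have up : ∀ n d, ℓ d = n → ∃ p : M.graph.Walk (M.vertex d) v₀, p.length ≤ n := by
    intro n
    induction n with
    | zero =>
      intro d hd
      rw [h0] at hd
      exact ⟨SimpleGraph.Walk.nil.copy hd.symm rfl, by simp⟩
    | succ n ih =>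
      intro d hd
      obtain ⟨d', h1, h2⟩ := hdesc d (by omega)
      obtain ⟨p, hp⟩ := ih (M.rev d') (by omega)
      rw [vertex_eq_iff.2 h1]
      rcases M.adj_or_eq d' with h | h
      · exact ⟨.cons h p, by simpa using hp⟩
      · exact ⟨p.copy h.symm rfl, by simp; omega⟩
  have low : ∀ (u w : M.Vertex) (p : M.graph.Walk u w) (d d' : D), M.vertex d = u →
      M.vertex d' = w → ℓ d ≤ ℓ d' + p.length := by
    intro u w p
    induction p with
    | nil => intro d d' h h'; rw [hlab d d' (h.trans h'.symm)]; simp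
    | cons hadj p ih =>
      intro d d' h h'
      rw [SimpleGraph.Walk.length_cons]
      rcases (SimpleGraph.fromRel_adj _ _ _).1 hadj with ⟨-, ⟨b, h1, h2⟩ | ⟨b, h1, h2⟩⟩
      · have := ih _ _ h2 h'
        have := hrev (M.rev b)
        rw [hrr] at this
        rw [hlab d b (h.trans h1.symm)]
        omega
      · have := ih _ _ h1 h'
        have := hrev b
        rw [hlab d _ (h.trans h2.symm)]
        omega
  have hconn : M.graph.Connected := by
    have hall : ∀ v, M.graph.Reachable v v₀ := fun v => by
      obtain ⟨d, rfl⟩ := M.vertex_surjective v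
      obtain ⟨p, -⟩ := up _ d rfl
      exact p.reachable
    exact { preconnected := fun u v => (hall u).trans (hall v).symm, nonempty := ⟨v₀⟩ }
  refine ⟨hconn, fun d => le_antisymm ?_ ?_⟩
  · obtain ⟨p, hp⟩ := up _ d rfl
    exact (SimpleGraph.dist_le p).trans hp
  · obtain ⟨o, ho⟩ := M.vertex_surjective v₀
    obtain ⟨p, hp⟩ := hconn.exists_walk_length_eq_dist (M.vertex d) v₀
    have := low _ _ p d o rfl ho
    rw [(h0 o).2 ho, zero_add, hp] at this
    exact this

variable {D' : Type} [Finite D'] {M' : RotationSystem D'} {v₀' : M'.Vertex}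

omit [Finite D'] in
-- The distances of `M'`, pulled back along `e`, have the local properties that characterise those
-- of `M`.
theorem Carries.distLabel_eq {e : D ≃ D'} (he : M.Carries M' e) (hM : M.IsMap) (hM' : M'.IsMap)
    (hv : ∀ d, M.vertex d = v₀ ↔ M'.vertex (e d) = v₀') (d : D) :
    M'.distLabel v₀' (e d) = M.distLabel v₀ d := by
  refine ((connected_and_distLabel_eq (fun d => M'.distLabel v₀' (e d)) hM.rev_rev
    (fun d => ?_) (fun d => ?_) (fun d => ?_) (fun d hd => ?_)).2 d).symm
  · rw [he.1, distLabel_rot]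
  · rw [he.2]
    exact distLabel_rev_le hM'.connected _
  · rw [distLabel_eq_zero_iff hM'.connected, hv]
  · obtain ⟨d', h1, h2⟩ := exists_descending hM' (e d) hd
    refine ⟨e.symm d', ?_, by rw [he.2, Equiv.apply_symm_apply, h2]⟩
    rwa [sameCycle_iff_of_conj e he.1, Equiv.apply_symm_apply]

omit [Finite D] [Finite D'] in
theorem Carries.next_symm_eq {e : D ≃ D'} (he : M.Carries M' e) (d : D) :
    e (M.next.symm d) = M'.next.symm (e d) := by
  rw [Equiv.eq_symm_apply, ← he.next, Equiv.apply_symm_apply]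

omit [Finite D] [Finite D'] in
theorem Carries.isMarked_iff {e : D ≃ D'} (he : M.Carries M' e)
    (hl : ∀ d, M'.distLabel v₀' (e d) = M.distLabel v₀ d) (d : D) :
    M.IsMarked v₀ d ↔ M'.IsMarked v₀' (e d) := by
  rw [IsMarked, IsMarked, hl, ← he.next_symm_eq, hl]

theorem Carries.opening {e : D ≃ D'} (he : M.Carries M' e)
    (hl : ∀ d, M'.distLabel v₀' (e d) = M.distLabel v₀ d) :
    (M.opening v₀).Carries (M'.opening v₀') (e.subtypeEquiv (he.isMarked_iff hl)) :=
  ⟨fun d => (firstReturn_conj e he.1 (he.isMarked_iff hl) d).symm,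
    fun d => (firstReturn_conj e he.next (he.isMarked_iff hl) d).symm⟩

end Distance

end RotationSystem

/-! ### The root of the opening -/

namespace RotationSystem

section Root

variable {D : Type} [Finite D] {M : RotationSystem D} {v₀ : M.Vertex}

open Classical in
/-- The sign of a root arc: `1` if labels increase along it. -/
noncomputable def arcSign (M : RotationSystem D) (v₀ : M.Vertex) (r : D) : ℤˣ :=
  if M.distLabel v₀ r < M.distLabel v₀ (M.rev r) then 1 else -1

theorem openingRoot_eq (hM : M.IsMap) (hb : M.IsBipartite) {r t : D} {k : ℕ}
    (ht : M.topCorner v₀ r = t) (hk : M.IsMarked v₀ ((M.next ^ k) t))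
    (hj : ∀ j < k, ¬ M.IsMarked v₀ ((M.next ^ j) t)) :
    (openingRoot hM hb v₀ r).1 = (M.next ^ k) t := by
  classical
  subst ht
  have : Nat.find (exists_marked hM hb v₀ (M.topCorner v₀ r)) = k := by
    rw [Nat.find_eq_iff]
    exact ⟨hk, fun j h => hj j h⟩
  simp only [openingRoot]
  rw [← this]

theorem openingRoot_of_lt (hM : M.IsMap) (hb : M.IsBipartite) {r : D}
    (h : M.distLabel v₀ r < M.distLabel v₀ (M.rev r)) :
    (openingRoot hM hb v₀ r).1 = M.next r := by
  have ht : M.topCorner v₀ r = M.next r := if_pos h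
  have hm : M.IsMarked v₀ (M.next r) := by rwa [isMarked_next_iff, distLabel_next]
  exact openingRoot_eq hM hb (k := 0) ht hm (by simp)

theorem openingRoot_of_marked (hM : M.IsMap) (hb : M.IsBipartite) {r : D}
    (h : ¬ M.distLabel v₀ r < M.distLabel v₀ (M.rev r)) (hm : M.IsMarked v₀ r) :
    (openingRoot hM hb v₀ r).1 = r := by
  have ht : M.topCorner v₀ r = r := if_neg h
  exact openingRoot_eq hM hb (k := 0) ht hm (by simp)

theorem IsQuad.openingRoot_of_unmarked (hM : M.IsQuad) {r : D}
    (h : ¬ M.distLabel v₀ r < M.distLabel v₀ (M.rev r)) (hm : ¬ M.IsMarked v₀ r) :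
    (openingRoot hM.toIsMap hM.bipartite v₀ r).1 = M.next (M.next r) := by
  have ht : M.topCorner v₀ r = r := if_neg h
  obtain ⟨x, y, z, w, hx, hy, hz, hw, c1, c2, c3, c4, m1, m2, m3, m4⟩ := hM.face_labels v₀ r
  rw [← distLabel_next] at h
  have n1 := mt m1.2 hm
  refine openingRoot_eq hM.toIsMap hM.bipartite (k := 2) ht (m3.2 (by omega)) (fun j hj => ?_)
  obtain rfl | rfl : j = 0 ∨ j = 1 := by omega
  · exact hm
  · exact mt m2.1 (by omega)

omit [Finite D] in
theorem arcSign_eq_one_iff (r : D) :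
    M.arcSign v₀ r = 1 ↔ M.distLabel v₀ r < M.distLabel v₀ (M.rev r) := by
  unfold arcSign
  split_ifs with h
  · simp [h]
  · simp only [h, iff_false]
    decide

/-- With sign `1` the new root is `M.next r`. With sign `-1` it is `r` or `M.next (M.next r)`; by
`key` labels increase along the latter arc, which therefore is not itself a root of sign `-1`. -/
theorem IsQuad.openingRoot_arcSign_injective (hM : M.IsQuad) (v₀ : M.Vertex) :
    Function.Injective fun r : D =>
      (openingRoot hM.toIsMap hM.bipartite v₀ r, M.arcSign v₀ r) := by
  intro r r' h
  obtain ⟨h1, h2⟩ := Prod.mk.inj h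
  replace h1 := congrArg Subtype.val h1
  have h3 : M.distLabel v₀ r < M.distLabel v₀ (M.rev r) ↔
      M.distLabel v₀ r' < M.distLabel v₀ (M.rev r') := by
    rw [← arcSign_eq_one_iff, ← arcSign_eq_one_iff, h2]
  have key : ∀ s, ¬ M.distLabel v₀ s < M.distLabel v₀ (M.rev s) → ¬ M.IsMarked v₀ s →
      M.distLabel v₀ (M.next (M.next s)) < M.distLabel v₀ (M.rev (M.next (M.next s))) := by
    intro s hs hm
    obtain ⟨x, y, z, w, hx, hy, hz, hw, c1, c2, c3, c4, m1, m2, m3, m4⟩ := hM.face_labels v₀ s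
    have n1 := mt m1.2 hm
    rw [← distLabel_next] at hs ⊢
    omega
  by_cases hr : M.distLabel v₀ r < M.distLabel v₀ (M.rev r)
  · rw [openingRoot_of_lt _ _ hr, openingRoot_of_lt _ _ (h3.1 hr)] at h1
    exact M.next.injective h1
  · have hr' := mt h3.2 hr
    by_cases hm : M.IsMarked v₀ r <;> by_cases hm' : M.IsMarked v₀ r'
    · rwa [openingRoot_of_marked _ _ hr hm, openingRoot_of_marked _ _ hr' hm'] at h1
    · rw [openingRoot_of_marked _ _ hr hm, hM.openingRoot_of_unmarked hr' hm'] at h1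
      exact absurd (h1 ▸ key r' hr' hm') hr
    · rw [openingRoot_of_marked _ _ hr' hm', hM.openingRoot_of_unmarked hr hm] at h1
      exact absurd (h1 ▸ key r hr hm) hr'
    · rw [hM.openingRoot_of_unmarked hr hm, hM.openingRoot_of_unmarked hr' hm'] at h1
      exact M.next.injective (M.next.injective h1)

/-- By counting: `arcEquiv` gives two arcs for each marked corner. -/
theorem IsQuad.openingRoot_arcSign_surjective (hM : M.IsQuad) (v₀ : M.Vertex) :
    Function.Surjective fun r : D =>
      (openingRoot hM.toIsMap hM.bipartite v₀ r, M.arcSign v₀ r) := by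
  have hu : Nat.card ℤˣ = Nat.card Bool := by simp [Nat.card_eq_fintype_card]
  have hcard : Nat.card ({d // M.IsMarked v₀ d} × ℤˣ) = Nat.card D := by
    rw [← Nat.card_congr (hM.arcEquiv v₀), Nat.card_prod, Nat.card_prod, hu]
  exact ((Nat.bijective_iff_injective_and_card _).2
    ⟨hM.openingRoot_arcSign_injective v₀, hcard.symm⟩).2

variable {D' : Type} [Finite D'] {M' : RotationSystem D'} {v₀' : M'.Vertex}

omit [Finite D] [Finite D'] in
theorem Carries.arcSign_eq {e : D ≃ D'} (he : M.Carries M' e)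
    (hl : ∀ d, M'.distLabel v₀' (e d) = M.distLabel v₀ d) (r : D) :
    M'.arcSign v₀' (e r) = M.arcSign v₀ r := by
  unfold arcSign
  rw [← he.2, hl, hl]

theorem IsQuad.apply_openingRoot (hM : M.IsQuad) (hM' : M'.IsQuad) {e : D ≃ D'}
    (he : M.Carries M' e) (hl : ∀ d, M'.distLabel v₀' (e d) = M.distLabel v₀ d) (r : D) :
    e (openingRoot hM.toIsMap hM.bipartite v₀ r).1
      = (openingRoot hM'.toIsMap hM'.bipartite v₀' (e r)).1 := by
  have hlt : M.distLabel v₀ r < M.distLabel v₀ (M.rev r) ↔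
      M'.distLabel v₀' (e r) < M'.distLabel v₀' (M'.rev (e r)) := by rw [← he.2, hl, hl]
  by_cases h : M.distLabel v₀ r < M.distLabel v₀ (M.rev r)
  · rw [openingRoot_of_lt _ _ h, openingRoot_of_lt _ _ (hlt.1 h), he.next]
  · by_cases hm : M.IsMarked v₀ r
    · rw [openingRoot_of_marked _ _ h hm, openingRoot_of_marked _ _ (mt hlt.2 h)
        ((he.isMarked_iff hl r).1 hm)]
    · rw [hM.openingRoot_of_unmarked h hm, hM'.openingRoot_of_unmarked (mt hlt.2 h)
        (mt (he.isMarked_iff hl r).2 hm), he.next, he.next]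

/-- A bijection between the arcs of the openings extends to the quadrangulations. -/
noncomputable def IsQuad.extend (hM : M.IsQuad) (hM' : M'.IsQuad)
    (e : {d // M.IsMarked v₀ d} ≃ {d // M'.IsMarked v₀' d}) : D ≃ D' :=
  (hM.arcEquiv v₀).symm.trans ((e.prodCongr (Equiv.refl Bool)).trans (hM'.arcEquiv v₀'))

omit [Finite D] [Finite D'] in
theorem IsQuad.extend_arcEquiv (hM : M.IsQuad) (hM' : M'.IsQuad)
    (e : {d // M.IsMarked v₀ d} ≃ {d // M'.IsMarked v₀' d}) (x : {d // M.IsMarked v₀ d} × Bool) :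
    hM.extend hM' e (hM.arcEquiv v₀ x) = hM'.arcEquiv v₀' (Prod.map e id x) := by
  simp [extend]

/-- Both rotations obey `Turn`, which is transported by `e` and deterministic; `rev` only flips the
Boolean. -/
theorem IsQuad.extend_carries (hM : M.IsQuad) (hM' : M'.IsQuad)
    {e : {d // M.IsMarked v₀ d} ≃ {d // M'.IsMarked v₀' d}}
    (he : (M.opening v₀).Carries (M'.opening v₀') e)
    (hl : ∀ c, M'.distLabel v₀' (e c).1 = M.distLabel v₀ c.1) :
    M.Carries M' (hM.extend hM' e) := by
  refine ⟨fun d => ?_, fun d => ?_⟩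
  · obtain ⟨x, rfl⟩ := (hM.arcEquiv v₀).surjective d
    obtain ⟨y, hy⟩ := (hM.arcEquiv v₀).surjective (M.rot (hM.arcEquiv v₀ x))
    obtain ⟨z, hz⟩ := (hM'.arcEquiv v₀').surjective
      (M'.rot (hM'.arcEquiv v₀' (Prod.map e id x)))
    rw [← hy, extend_arcEquiv, extend_arcEquiv, ← hz]
    have h1 := (hM.turn_arcEquiv hy.symm).map he (fun c => by exact_mod_cast hl c)
      (ℓ' := fun d => (M'.distLabel v₀' d.1 : ℤ))
    rw [h1.right_unique (hM'.turn_arcEquiv hz.symm)]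
  · obtain ⟨x, rfl⟩ := (hM.arcEquiv v₀).surjective d
    rw [← hM.arcEquiv_not, extend_arcEquiv, extend_arcEquiv, ← hM'.arcEquiv_not]
    rfl

omit [Finite D] in
theorem IsQuad.distLabel_arcEquiv (hM : M.IsQuad) (c : {d // M.IsMarked v₀ d}) (b : Bool) :
    M.distLabel v₀ (hM.arcEquiv v₀ (c, b)) + (if b then 0 else 1) = M.distLabel v₀ c.1 := by
  cases b
  · obtain ⟨c, hc⟩ := c
    obtain ⟨a, rfl⟩ := M.next.surjective c
    have h1 := (isMarked_next_iff _).1 hc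
    have h2 := distLabel_next_cases hM.toIsMap hM.bipartite v₀ a
    rw [arcEquiv_false]
    simp only [Equiv.symm_apply_apply, Bool.false_eq_true, if_false]
    omega
  · rw [arcEquiv_true, ← distLabel_rot, Equiv.apply_symm_apply]
    rfl

omit [Finite D] [Finite D'] in
theorem IsQuad.distLabel_extend (hM : M.IsQuad) (hM' : M'.IsQuad)
    {e : {d // M.IsMarked v₀ d} ≃ {d // M'.IsMarked v₀' d}}
    (hl : ∀ c, M'.distLabel v₀' (e c).1 = M.distLabel v₀ c.1) (d : D) :
    M'.distLabel v₀' (hM.extend hM' e d) = M.distLabel v₀ d := by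
  obtain ⟨⟨c, b⟩, rfl⟩ := (hM.arcEquiv v₀).surjective d
  rw [extend_arcEquiv]
  have h1 := hM.distLabel_arcEquiv c b
  have h2 := hM'.distLabel_arcEquiv (e c) b
  rw [hl] at h2
  simp only [Prod.map_apply, id]
  omega

theorem IsQuad.extend_marked (hM : M.IsQuad) (hM' : M'.IsQuad)
    {e : {d // M.IsMarked v₀ d} ≃ {d // M'.IsMarked v₀' d}}
    (he : (M.opening v₀).Carries (M'.opening v₀') e)
    (hl : ∀ c, M'.distLabel v₀' (e c).1 = M.distLabel v₀ c.1) (c : {d // M.IsMarked v₀ d}) :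
    hM.extend hM' e c.1 = (e c).1 := by
  have h1 : c.1 = M.rot (hM.arcEquiv v₀ (c, true)) := by
    rw [arcEquiv_true, Equiv.apply_symm_apply]
  rw [h1, (hM.extend_carries hM' he hl).1, extend_arcEquiv, Prod.map_apply, id,
    arcEquiv_true]
  simp

/-- The opening with its root and the sign of the root determines the quadrangulation. -/
theorem IsQuad.exists_carries_of_opening (hM : M.IsQuad) (hM' : M'.IsQuad) {r : D} {r' : D'}
    {e : {d // M.IsMarked v₀ d} ≃ {d // M'.IsMarked v₀' d}}
    (he : (M.opening v₀).Carries (M'.opening v₀') e)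
    (hl : ∀ c, M'.distLabel v₀' (e c).1 = M.distLabel v₀ c.1)
    (hr : e (openingRoot hM.toIsMap hM.bipartite v₀ r)
      = openingRoot hM'.toIsMap hM'.bipartite v₀' r')
    (hs : M.arcSign v₀ r = M'.arcSign v₀' r') :
    ∃ ε : D ≃ D', M.Carries M' ε ∧ ε r = r' ∧
      ∀ d, M.vertex d = v₀ ↔ M'.vertex (ε d) = v₀' := by
  have h1 := hM.extend_carries hM' he hl
  have h2 := hM.distLabel_extend hM' hl
  refine ⟨hM.extend hM' e, h1, hM'.openingRoot_arcSign_injective v₀' (Prod.ext ?_ ?_), fun d => ?_⟩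
  · apply Subtype.ext
    simp only
    rw [← hM.apply_openingRoot hM' h1 h2, hM.extend_marked hM' he hl, hr]
  · change M'.arcSign v₀' _ = M'.arcSign v₀' _
    rw [h1.arcSign_eq h2, hs]
  · rw [← distLabel_eq_zero_iff hM.connected, ← distLabel_eq_zero_iff hM'.connected, h2]

end Root

end RotationSystem

/-! ### The closure of a labelled one-face map -/

namespace RotationSystem

namespace IsLabelledOneFace

variable {C : Type} [Finite C] {T : RotationSystem C} {ℓ : C → ℤ} (hT : T.IsLabelledOneFace ℓ)
  (hmin : IsLeast (Set.range ℓ) 1)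

/-- The closure: each corner of the map is joined to the next corner with a smaller label. -/
noncomputable def closure : RotationSystem (C × Bool) where
  rot := Equiv.ofBijective (fun x => (hT.exists_turn hmin x).choose)
    (Finite.injective_iff_bijective.1 fun x y h => hT.turn_left_unique
      (hT.exists_turn hmin x).choose_spec (by
        rw [h]
        exact (hT.exists_turn hmin y).choose_spec))
  rev := (Equiv.refl C).prodCongr Equiv.boolNot

/-- The labels of the vertices of the closure. -/
def closureLabel (ℓ : C → ℤ) (x : C × Bool) : ℕ := (if x.2 then ℓ x.1 else ℓ x.1 - 1).toNat

theorem turn_closure (x : C × Bool) : Turn T ℓ x ((hT.closure hmin).rot x) :=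
  (hT.exists_turn hmin x).choose_spec

theorem closure_rot_eq {x y : C × Bool} (h : Turn T ℓ x y) : (hT.closure hmin).rot x = y :=
  (hT.turn_closure hmin x).right_unique h

theorem closure_rev (c : C) (b : Bool) : (hT.closure hmin).rev (c, b) = (c, !b) := rfl

theorem closure_next_eq {c : C} {b : Bool} {y : C × Bool} (h : Turn T ℓ (c, !b) y) :
    (hT.closure hmin).next (c, b) = y :=
  hT.closure_rot_eq hmin h

include hmin in
omit [Finite C] in
theorem coe_closureLabel (x : C × Bool) :
    (closureLabel ℓ x : ℤ) = if x.2 then ℓ x.1 else ℓ x.1 - 1 := by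
  have : 1 ≤ ℓ x.1 := hmin.2 ⟨_, rfl⟩
  unfold closureLabel
  split_ifs <;> omega

theorem closureLabel_rot (x : C × Bool) :
    closureLabel ℓ ((hT.closure hmin).rot x) = closureLabel ℓ x := by
  have h := hT.turn_closure hmin x
  zify
  rw [coe_closureLabel hmin, coe_closureLabel hmin]
  generalize (hT.closure hmin).rot x = y at h
  cases h with
  | down_up c h => simp [h]
  | down_down c h => simp [hT.lab_rot]
  | up_up c c' h hl => simp [hl]
  | up_down c d hc h hd => simp [hd]

theorem closureLabel_rev (x : C × Bool) :
    (closureLabel ℓ ((hT.closure hmin).rev x) : ℤ)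
      = closureLabel ℓ x + (if x.2 then -1 else 1) := by
  obtain ⟨c, _ | _⟩ := x <;> rw [closure_rev, coe_closureLabel hmin, coe_closureLabel hmin]
  · simp
  · simp; rfl

/-! ### The faces of the closure -/

theorem exists_next_down {c : C} (h : ℓ (T.rev c) = ℓ c + 1) :
    ∃ s, (hT.closure hmin).next (T.next c, true) = (s, true) ∧
      (hT.closure hmin).next (s, true) = (c, false) := by
  have h1 := hT.lab_next c
  generalize hx : (T.next c, false) = x
  obtain ⟨y, hy⟩ : ∃ y, y = (hT.closure hmin).rot x := ⟨_, rfl⟩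
  have ht := hT.turn_closure hmin x
  rw [← hy] at ht
  cases ht with
  | down_up => simp at hx
  | down_down => simp at hx
  | up_up d c' h' hl =>
    simp only [Prod.mk.injEq, and_true] at hx
    subst hx
    rcases h'.inv_apply_eq_or_lt with h2 | h2 <;>
      simp only [Equiv.Perm.coe_inv, Equiv.symm_apply_apply] at h2
    · subst h2; omega
    · omega
  | up_down d s hc h' hd =>
    simp only [Prod.mk.injEq, and_true] at hx
    subst hx
    have h2 : ℓ (T.next c) - 1 = ℓ c := by omega
    rw [h2] at h' hd
    refine ⟨s, hy.symm, hT.closure_next_eq hmin (.up_up _ _ ?_ hd.symm)⟩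
    rw [hd]
    exact h'.of_apply (by omega)

theorem next_up_up {c : C} (h : ℓ (T.rev c) = ℓ c + 1) :
    (hT.closure hmin).next (c, false) = (T.rev c, false) :=
  hT.closure_next_eq hmin (.down_up c h)

theorem next_up_down {c : C} (h : ℓ (T.rev c) ≠ ℓ c + 1) :
    (hT.closure hmin).next (c, false) = (T.next (T.rev c), true) := by
  rw [hT.rev_eq_of_next]
  exact hT.closure_next_eq hmin (.down_down c h)

theorem next_down_up {c : C} (h : ℓ (T.rev c) = ℓ c) :
    (hT.closure hmin).next (T.next c, true) = (c, false) := by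
  have h1 := hT.lab_next c
  exact hT.closure_next_eq hmin (.up_up _ _ (Excursion.single _ _ _ _) (by omega))

/-- The face in which an edge of a labelled one-face map is drawn. -/
theorem closure_face (c : C) :
    ∃ x y z, (hT.closure hmin).next (c, false) = x ∧ (hT.closure hmin).next x = y ∧
      (hT.closure hmin).next y = z ∧ (hT.closure hmin).next z = (c, false) ∧ y ≠ (c, false) ∧
      (x = (T.rev c, false) ∨ (x.2 = true ∧ y = (T.rev c, false)) ∨
        (x.2 = true ∧ y.2 = true ∧ z = (T.rev c, false))) := by
  have hr := hT.rev_rev c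
  have hne := hT.rev_ne c
  have hb := abs_le.1 (hT.lab_rev c)
  obtain h | h | h : ℓ (T.rev c) = ℓ c + 1 ∨ ℓ (T.rev c) = ℓ c ∨ ℓ c = ℓ (T.rev c) + 1 := by omega
  · obtain ⟨s, h1, h2⟩ := hT.exists_next_down hmin h
    refine ⟨_, _, _, hT.next_up_up hmin h, hT.next_up_down hmin (by rw [hr]; omega), ?_, h2, ?_,
      .inl rfl⟩
    · rw [hr, h1]
    · simp
  · refine ⟨_, _, _, hT.next_up_down hmin (by omega), hT.next_down_up hmin (by rw [hr, h]),
      hT.next_up_down hmin (by rw [hr]; omega), ?_, ?_, .inr (.inl ⟨rfl, rfl⟩)⟩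
    · rw [hr, hT.next_down_up hmin h]
    · simpa using hne
  · obtain ⟨s, h1, h2⟩ := hT.exists_next_down hmin (c := T.rev c) (by rw [hr]; exact h)
    refine ⟨_, _, _, hT.next_up_down hmin (by omega), h1, h2, ?_, ?_, .inr (.inr ⟨rfl, rfl, rfl⟩)⟩
    · have := hT.next_up_up hmin (c := T.rev c) (by rw [hr]; exact h)
      rwa [hr] at this
    · simp

theorem exists_next_eq_up (x : C × Bool) :
    ∃ c, x = (c, false) ∨ (hT.closure hmin).next x = (c, false) ∨
      (hT.closure hmin).next ((hT.closure hmin).next x) = (c, false) := by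
  obtain ⟨c, _ | _⟩ := x
  · exact ⟨c, .inl rfl⟩
  · have key : ∀ d, (∃ e, Turn T ℓ (d, false) (e, false)) ∨ ∃ s,
        Turn T ℓ (d, false) (s, true) ∧ ℓ (T.next⁻¹ d) = ℓ d - 1 ∧
          Excursion T.next ℓ (ℓ d - 1) d s ∧ ℓ s = ℓ d - 1 := by
      intro d
      generalize hx : (d, false) = x
      obtain ⟨y, hy⟩ := hT.exists_turn hmin x
      cases hy with
      | down_up => simp at hx
      | down_down => simp at hx
      | up_up d' e h hl => exact .inl ⟨e, .up_up d' e h hl⟩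
      | up_down d' s hc h hd =>
        simp only [Prod.mk.injEq, and_true] at hx
        subst hx
        exact .inr ⟨s, .up_down d s hc h hd, hc, h, hd⟩
    rcases key c with ⟨e, he⟩ | ⟨s, hs, -, hex, hl⟩
    · exact ⟨e, .inr (.inl (hT.closure_next_eq hmin he))⟩
    · rcases key s with ⟨e, he⟩ | ⟨s', -, h2, -, -⟩
      · refine ⟨e, .inr (.inr ?_)⟩
        rw [show (hT.closure hmin).next (c, true) = (s, true) from hT.closure_next_eq hmin hs]
        exact hT.closure_next_eq hmin he
      · rcases hex.inv_apply_eq_or_lt with h3 | h3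
        · rw [h3] at h2; omega
        · omega

theorem closure_next_four (x : C × Bool) :
    (hT.closure hmin).next ((hT.closure hmin).next ((hT.closure hmin).next
      ((hT.closure hmin).next x))) = x := by
  have key : ∀ c, (hT.closure hmin).next ((hT.closure hmin).next ((hT.closure hmin).next
      ((hT.closure hmin).next (c, false)))) = (c, false) := fun c => by
    obtain ⟨x, y, z, h1, h2, h3, h4, -⟩ := hT.closure_face hmin c
    rw [h1, h2, h3, h4]
  obtain ⟨c, rfl | h | h⟩ := hT.exists_next_eq_up hmin x
  · exact key c
  · apply (hT.closure hmin).next.injective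
    rw [h, key]
  · apply (hT.closure hmin).next.injective
    apply (hT.closure hmin).next.injective
    rw [h, key]

theorem closure_next_two_ne (x : C × Bool) :
    (hT.closure hmin).next ((hT.closure hmin).next x) ≠ x := by
  have key : ∀ c, (hT.closure hmin).next ((hT.closure hmin).next (c, false)) ≠ (c, false) :=
    fun c => by
      obtain ⟨x, y, z, h1, h2, -, -, h5, -⟩ := hT.closure_face hmin c
      rwa [h1, h2]
  intro hx
  obtain ⟨c, rfl | h | h⟩ := hT.exists_next_eq_up hmin x
  · exact key c hx
  · apply key c
    rw [← h, hx]
  · apply key c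
    rw [← h, hx, hx]

/-- Rotating around the origin from an increasing arc leads to the first decreasing arc. -/
theorem exists_pow_rot_up {c s : C} (h : Excursion T.next ℓ (ℓ c - 1) c s) (hs : ℓ s = ℓ c - 1) :
    ∃ k, 0 < k ∧ ((hT.closure hmin).rot ^ k) (c, false) = (s, true) ∧
      ∀ j < k, (((hT.closure hmin).rot ^ j) (c, false)).2 = false := by
  obtain ⟨m, hm, hms, hj⟩ := h
  obtain ⟨n, hn⟩ : ∃ n, orderOf T.next < m + n := ⟨orderOf T.next + 1, by omega⟩
  induction n generalizing m c with
  | zero =>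
    have ho := orderOf_pos T.next
    have h1 : (T.next ^ (m - orderOf T.next)) c = s := by
      rw [← hms]
      nth_rewrite 2 [show m = m - orderOf T.next + orderOf T.next by omega]
      rw [pow_add, pow_orderOf_eq_one, mul_one]
    have h2 := hj (m - orderOf T.next) (by omega) (by omega)
    rw [h1] at h2
    omega
  | succ n ih =>
    have hex : Excursion T.next ℓ (ℓ c - 1) c s := ⟨m, hm, hms, hj⟩
    generalize hx : (c, false) = x
    obtain ⟨y, hy⟩ := hT.exists_turn hmin x
    have hy' := hT.closure_rot_eq hmin hy
    cases hy with
    | down_up => simp at hx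
    | down_down => simp at hx
    | up_up d c' h' hl =>
      simp only [Prod.mk.injEq, and_true] at hx
      subst hx
      obtain ⟨i, hi, hic, hij⟩ := h'
      obtain ⟨k, hk, hks, hkj⟩ := ih (c := c') (by omega) (m + i) (by omega)
        (by rw [pow_add, Equiv.Perm.mul_apply, hic, hms]) (fun j h1 h2 => by
          rcases lt_trichotomy j i with hlt | rfl | hgt
          · have := hij j h1 hlt; omega
          · rw [hic]; omega
          · obtain ⟨j', rfl⟩ := Nat.exists_eq_add_of_le' hgt.le
            rw [pow_add, Equiv.Perm.mul_apply, hic, hl]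
            exact hj j' (by omega) (by omega)) (by omega)
      refine ⟨k + 1, by omega, by rw [pow_succ, Equiv.Perm.mul_apply, hy', hks], fun j hjk => ?_⟩
      cases j with
      | zero => rfl
      | succ j =>
        rw [pow_succ, Equiv.Perm.mul_apply, hy']
        exact hkj j (by omega)
    | up_down d s' hc h' hd =>
      simp only [Prod.mk.injEq, and_true] at hx
      subst hx
      obtain rfl := hex.right_unique h' hs.le hd.le
      exact ⟨1, one_pos, by simpa using hy', fun j hj => by
        obtain rfl : j = 0 := by omega
        rfl⟩

theorem exists_pow_rot_down (c : C) :
    ∃ k, 0 < k ∧ ((hT.closure hmin).rot ^ k) (c, true) = (T.rot c, true) ∧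
      ∀ j, 0 < j → j < k → (((hT.closure hmin).rot ^ j) (c, true)).2 = false := by
  by_cases h : ℓ (T.rev c) = ℓ c + 1
  · have h1 := hT.closure_rot_eq hmin (.down_up c h)
    have h2 := hT.lab_rot c
    have hs := Excursion.single T.next ℓ (ℓ (T.rev c) - 1) (T.rev c)
    rw [hT.rev_eq_of_next] at hs
    obtain ⟨k, hk, hks, hkj⟩ := hT.exists_pow_rot_up hmin hs (by omega)
    refine ⟨k + 1, by omega, by rw [pow_succ, Equiv.Perm.mul_apply, h1, hks], fun j h0 hjk => ?_⟩
    obtain ⟨j, rfl⟩ : ∃ i, j = i + 1 := ⟨j - 1, by omega⟩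
    rw [pow_succ, Equiv.Perm.mul_apply, h1]
    exact hkj j (by omega)
  · exact ⟨1, one_pos, by simpa using hT.closure_rot_eq hmin (.down_down c h),
      fun j h0 h1 => by omega⟩

/-- The corners with label one are joined to the same vertex. -/
theorem rot_sameCycle_of_eq_one {c o : C} (hc : ℓ c = 1) (ho : ℓ o = 1) :
    (hT.closure hmin).rot.SameCycle (c, false) (o, false) := by
  obtain ⟨k, hk⟩ := (hT.next_sameCycle o c).exists_nat_pow_eq
  induction k using Nat.strong_induction_on generalizing c with
  | _ k ih =>
    rcases Nat.eq_zero_or_pos k with rfl | hpos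
    · simp only [pow_zero, Equiv.Perm.one_apply] at hk
      rw [hk]
    · generalize hx : (c, false) = x
      obtain ⟨y, hy⟩ := hT.exists_turn hmin x
      have hy' := hT.closure_rot_eq hmin hy
      cases hy with
      | down_up => simp at hx
      | down_down => simp at hx
      | up_up d c' h' hl =>
        simp only [Prod.mk.injEq, and_true] at hx
        subst hx
        obtain ⟨i, hi, hic, hij⟩ := h'
        have hik : i ≤ k := by
          by_contra! hlt
          have h1 : (T.next ^ (i - k)) c' = o := by
            apply (T.next ^ k).injective
            rw [hk, ← hic, ← Equiv.Perm.mul_apply, ← pow_add]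
            congr 2
            omega
          have h2 := hij (i - k) (by omega) (by omega)
          rw [h1] at h2
          omega
        have h3 : (T.next ^ (k - i)) o = c' := by
          apply (T.next ^ i).injective
          rw [hic, ← hk, ← Equiv.Perm.mul_apply, ← pow_add]
          congr 2
          omega
        have h4 := ih (k - i) (by omega) (by omega) h3
        rw [← hy', Equiv.Perm.sameCycle_apply_left] at h4
        exact h4
      | up_down d s hcd h' hd =>
        simp only [Prod.mk.injEq, and_true] at hx
        subst hx
        have : 1 ≤ ℓ s := hmin.2 ⟨_, rfl⟩
        omega

theorem closure_connected_and_distLabel {o : C} (ho : ℓ o = 1) :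
    (hT.closure hmin).graph.Connected ∧ ∀ x, (hT.closure hmin).distLabel
      ((hT.closure hmin).vertex (o, false)) x = closureLabel ℓ x := by
  have hlo : closureLabel ℓ (o, false) = 0 := by simp [closureLabel, ho]
  refine connected_and_distLabel_eq (closureLabel ℓ) (fun x => ?_) (hT.closureLabel_rot hmin)
    (fun x => ?_) (fun x => ⟨fun hx => ?_, fun hx => ?_⟩) (fun x hx => ?_)
  · obtain ⟨c, b⟩ := x
    rw [closure_rev, closure_rev, Bool.not_not]
  · have := hT.closureLabel_rev hmin x
    split_ifs at this <;> omega
  · have h1 := coe_closureLabel hmin x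
    obtain ⟨c, b⟩ := x
    have h2 : 1 ≤ ℓ c := hmin.2 ⟨_, rfl⟩
    cases b
    · simp only [Bool.false_eq_true, if_false] at h1
      exact vertex_eq_iff.2 (hT.rot_sameCycle_of_eq_one hmin (by omega) ho)
    · simp only [if_true] at h1
      omega
  · obtain ⟨n, rfl⟩ := (vertex_eq_iff.1 hx.symm).exists_nat_pow_eq
    clear hx
    induction n with
    | zero => exact hlo
    | succ n ih => rw [pow_succ', Equiv.Perm.mul_apply, closureLabel_rot, ih]
  · obtain ⟨c, b⟩ := x
    have h1 := coe_closureLabel hmin (c, b)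
    cases b
    · simp only [Bool.false_eq_true, if_false] at h1
      obtain ⟨s, hs, hl⟩ := Excursion.exists_of_sameCycle (f := T.next) (ℓ := ℓ) (h := ℓ c - 1)
        (c := c) (fun x => by
          have := abs_le.1 (hT.lab_rev x)
          rw [hT.lab_next]; omega) (by left; omega) (hT.next_sameCycle c o) (by omega)
      obtain ⟨k, -, hk, -⟩ := hT.exists_pow_rot_up hmin hs hl
      refine ⟨(s, true), ⟨k, by rw [zpow_natCast, hk]⟩, ?_⟩
      have h2 := hT.closureLabel_rev hmin (s, true)
      have h3 := coe_closureLabel hmin (s, true)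
      simp only [if_true] at h2 h3
      omega
    · refine ⟨(c, true), Equiv.Perm.SameCycle.refl _ _, ?_⟩
      have h2 := hT.closureLabel_rev hmin (c, true)
      simp only [if_true] at h2
      omega

theorem closure_isQuad : (hT.closure hmin).IsQuad := by
  obtain ⟨o, ho⟩ := hmin.1
  obtain ⟨hc, hl⟩ := hT.closure_connected_and_distLabel hmin ho
  refine { rev_rev := fun ⟨c, b⟩ => by rw [closure_rev, closure_rev, Bool.not_not]
           rev_ne := fun ⟨c, b⟩ => by rw [closure_rev]; simp
           connected := hc
           bipartite := ?_
           next_four := hT.closure_next_four hmin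
           next_two_ne := hT.closure_next_two_ne hmin }
  classical
  refine ⟨fun v => decide (Even ((hT.closure hmin).graph.dist v
    ((hT.closure hmin).vertex (o, false)))), fun x h => ?_⟩
  rw [decide_eq_decide] at h
  change Even ((hT.closure hmin).distLabel _ x) ↔ Even ((hT.closure hmin).distLabel _ _) at h
  rw [hl, hl] at h
  have := hT.closureLabel_rev hmin x
  rw [Nat.even_iff, Nat.even_iff] at h
  split_ifs at this <;> omega

theorem closure_isMarked_rot_iff {o : C} (ho : ℓ o = 1) (x : C × Bool) :
    (hT.closure hmin).IsMarked ((hT.closure hmin).vertex (o, false)) ((hT.closure hmin).rot x)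
      ↔ x.2 = true := by
  have := hT.closureLabel_rev hmin x
  rw [isMarked_rot_iff (hT.closure_isQuad hmin).toIsMap,
    (hT.closure_connected_and_distLabel hmin ho).2, (hT.closure_connected_and_distLabel hmin ho).2]
  split_ifs at this with h
  · simp only [h, iff_true]
    omega
  · simp only [h, Bool.false_eq_true, iff_false]
    omega

/-- The corners of a labelled one-face map are the marked corners of its closure. -/
noncomputable def closureEquiv {o : C} (ho : ℓ o = 1) :
    C ≃ {x // (hT.closure hmin).IsMarked ((hT.closure hmin).vertex (o, false)) x} :=
  Equiv.ofBijective (fun c => ⟨(hT.closure hmin).rot (c, true),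
    (hT.closure_isMarked_rot_iff hmin ho _).2 rfl⟩) (by
    constructor
    · intro c d h
      have h1 : (hT.closure hmin).rot (c, true) = (hT.closure hmin).rot (d, true) :=
        congrArg Subtype.val h
      exact congrArg Prod.fst ((hT.closure hmin).rot.injective h1)
    · rintro ⟨x, hx⟩
      obtain ⟨⟨c, b⟩, rfl⟩ := (hT.closure hmin).rot.surjective x
      obtain rfl : b = true := (hT.closure_isMarked_rot_iff hmin ho _).1 hx
      exact ⟨c, rfl⟩)

theorem coe_closureEquiv {o : C} (ho : ℓ o = 1) (c : C) :
    (hT.closureEquiv hmin ho c).1 = (hT.closure hmin).rot (c, true) := rfl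

theorem distLabel_closureEquiv {o : C} (ho : ℓ o = 1) (c : C) :
    ((hT.closure hmin).distLabel ((hT.closure hmin).vertex (o, false))
      (hT.closureEquiv hmin ho c).1 : ℤ) = ℓ c := by
  rw [coe_closureEquiv, distLabel_rot, (hT.closure_connected_and_distLabel hmin ho).2,
    coe_closureLabel hmin]
  rfl

/-- The opening of the closure. -/
theorem closureEquiv_carries {o : C} (ho : ℓ o = 1) :
    T.Carries ((hT.closure hmin).opening ((hT.closure hmin).vertex (o, false)))
      (hT.closureEquiv hmin ho) := by
  have hmark := hT.closure_isMarked_rot_iff hmin ho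
  refine ⟨fun c => Eq.symm ?_, fun c => Eq.symm ?_⟩
  · obtain ⟨k, hk, hks, hkj⟩ := hT.exists_pow_rot_down hmin c
    have hcomm : ∀ j x, ((hT.closure hmin).rot ^ j) ((hT.closure hmin).rot x)
        = (hT.closure hmin).rot (((hT.closure hmin).rot ^ j) x) := fun j x => by
      rw [← Equiv.Perm.mul_apply, ← Equiv.Perm.mul_apply, ← pow_succ, ← pow_succ']
    refine firstReturn_eq_of_pow hk ?_ fun j h0 h1 => ?_
    · rw [coe_closureEquiv, coe_closureEquiv, hcomm, hks]
    · rw [coe_closureEquiv, hcomm, hmark, hkj j h0 h1]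
      simp
  · have hrot : ∀ d, (hT.closure hmin).rot (d, true) = (hT.closure hmin).next (d, false) :=
      fun d => rfl
    have hmark' : ∀ x, (hT.closure hmin).IsMarked ((hT.closure hmin).vertex (o, false))
        ((hT.closure hmin).next x) ↔ x.2 = false := fun ⟨d, b⟩ => by
      rw [next_apply, hmark, closure_rev]
      cases b <;> simp
    obtain ⟨x, y, z, h1, h2, h3, h4, -, h⟩ := hT.closure_face hmin c
    have hx : ((hT.closureEquiv hmin ho c)).1 = x := by rw [coe_closureEquiv, hrot, h1]
    rcases h with h | ⟨g1, h⟩ | ⟨g1, g2, h⟩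
    · refine firstReturn_eq_of_pow one_pos ?_ fun j h0 h1 => by omega
      rw [coe_closureEquiv _ _ _ (T.rev c), hrot, hx, pow_one, h]
    · refine firstReturn_eq_of_pow two_pos ?_ fun j hj0 hj1 => ?_
      · rw [coe_closureEquiv _ _ _ (T.rev c), hrot, hx, pow_two, Equiv.Perm.mul_apply, h2, h]
      · obtain rfl : j = 1 := by omega
        rw [hx, pow_one, hmark', g1]
        simp
    · refine firstReturn_eq_of_pow three_pos ?_ fun j hj0 hj1 => ?_
      · rw [coe_closureEquiv _ _ _ (T.rev c), hrot, hx, ← h, ← h3, ← h2]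
        rfl
      · obtain rfl | rfl : j = 1 ∨ j = 2 := by omega
        · rw [hx, pow_one, hmark', g1]
          simp
        · rw [hx, pow_two, Equiv.Perm.mul_apply, h2, hmark', g2]
          simp

end IsLabelledOneFace

end RotationSystem

/-! ### The bijections -/

open RotationSystem

namespace RootedPointedQuad

variable {g n g' n' : ℕ}

theorem isQuad (q : RootedPointedQuad g n) : q.1.M.IsQuad :=
  have : Finite q.1.D := q.1.finite_D
  q.2.isQuad

theorem isLeast_opened_lab (q : RootedPointedQuad g n) : IsLeast (Set.range q.opened.lab) 1 := by
  constructor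
  · obtain ⟨d, hd⟩ := q.1.M.vertex_surjective q.1.base
    have h0 := (distLabel_eq_zero_iff q.isQuad.connected d).2 hd
    have h1 := distLabel_next_cases q.isQuad.toIsMap q.isQuad.bipartite q.1.base d
    refine ⟨⟨q.1.M.next d, q.isQuad.isMarked_next_of_distLabel_eq_zero h0⟩, ?_⟩
    change (q.1.M.distLabel q.1.base (q.1.M.next d) : ℤ) = 1
    omega
  · rintro _ ⟨⟨d, hd⟩, rfl⟩
    change 1 ≤ (q.1.M.distLabel q.1.base d : ℤ)
    rw [IsMarked] at hd
    omega

theorem opened_isLabelledOneFace (q : RootedPointedQuad g n) :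
    q.opened.M.IsLabelledOneFace q.opened.lab :=
  have : Finite q.1.D := q.1.finite_D
  q.isQuad.opening_isLabelledOneFace

theorem opened_isGTree (q : RootedPointedQuad g n) : q.opened.M.IsGTree g n :=
  have : Finite q.1.D := q.1.finite_D
  have : Nonempty {d // q.1.M.IsMarked q.1.base d} := ⟨q.opened.root⟩
  q.isQuad.opening_isGTree q.2.euler q.2.card_face

theorem relabel_opened_isEmbedded (q : RootedPointedQuad g n) : q.opened.relabel.IsEmbedded where
  lab_rot d := by
    have := q.opened_isLabelledOneFace.lab_rot d
    change q.opened.lab (q.opened.M.rot d) - _ + 1 = q.opened.lab d - _ + 1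
    rw [this]
  lab_rev d := by
    have := q.opened_isLabelledOneFace.lab_rev d
    change |(q.opened.lab (q.opened.M.rev d) - _ + 1) - (q.opened.lab d - _ + 1)| ≤ 1
    convert this using 2
    ring
  lab_root := by
    change q.opened.lab q.opened.root - q.opened.lab q.opened.root + 1 = 1
    ring

theorem sign_eq (q : RootedPointedQuad g n) : q.sign = q.1.M.arcSign q.1.base q.1.root := rfl

theorem opened_lab_root (q : RootedPointedQuad g n) (h : q.sign = 1) :
    q.opened.lab q.opened.root = q.1.M.distLabel q.1.base q.1.root + 1 := by
  have : Finite q.1.D := q.1.finite_D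
  rw [sign_eq, arcSign_eq_one_iff] at h
  change (q.1.M.distLabel q.1.base (openingRoot q.2.toIsMap q.2.bipartite _ _).1 : ℤ) = _
  have h1 := distLabel_next_cases q.isQuad.toIsMap q.isQuad.bipartite q.1.base q.1.root
  rw [openingRoot_of_lt _ _ h]
  rw [← distLabel_next] at h
  omega

theorem opened_equiv_of_equiv {q : RootedPointedQuad g n} {q' : RootedPointedQuad g' n'}
    (h : q.1 ≈ q'.1) : q.opened ≈ q'.opened ∧ q.sign = q'.sign := by
  have : Finite q.1.D := q.1.finite_D
  have : Finite q'.1.D := q'.1.finite_D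
  obtain ⟨e, he, hr, hb⟩ := h
  have hl := he.distLabel_eq q.2.toIsMap q'.2.toIsMap hb
  refine ⟨⟨e.subtypeEquiv (he.isMarked_iff hl), he.opening hl, Subtype.ext ?_, fun d => ?_⟩, ?_⟩
  · have := q.isQuad.apply_openingRoot q'.isQuad he hl q.1.root
    rw [hr] at this
    exact this
  · exact congrArg Nat.cast (hl d.1)
  · rw [sign_eq, sign_eq, ← hr, he.arcSign_eq hl]

theorem equiv_of_opened_equiv {q : RootedPointedQuad g n} {q' : RootedPointedQuad g' n'}
    (h : q.opened ≈ q'.opened) (hs : q.sign = q'.sign) : q.1 ≈ q'.1 := by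
  have : Finite q.1.D := q.1.finite_D
  have : Finite q'.1.D := q'.1.finite_D
  obtain ⟨e, he, hr, hl⟩ := h
  exact q.isQuad.exists_carries_of_opening q'.isQuad he
    (fun c => Int.ofNat.inj (hl c)) hr hs

theorem opened_equiv_of_relabel_equiv {q : RootedPointedQuad g n} {q' : RootedPointedQuad g' n'}
    (h : q.opened.relabel ≈ q'.opened.relabel) : q.opened ≈ q'.opened := by
  obtain ⟨e, he, hr, hl⟩ := h
  refine ⟨e, he, hr, ?_⟩
  have hl' : ∀ d, q'.opened.lab (e d) - q'.opened.lab q'.opened.root + 1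
      = q.opened.lab d - q.opened.lab q.opened.root + 1 := hl
  have h1 := q.isLeast_opened_lab
  have h2 := q'.isLeast_opened_lab
  obtain ⟨a, ha⟩ := h1.1
  obtain ⟨b, hb⟩ := h2.1
  have h3 := hl' a
  have h4 : 1 ≤ q'.opened.lab (e a) := h2.2 ⟨_, rfl⟩
  obtain ⟨b, rfl⟩ := e.surjective b
  have h5 := hl' b
  have h6 : 1 ≤ q.opened.lab b := h1.2 ⟨_, rfl⟩
  intro d
  have h7 := hl' d
  omega

/-- Every labelled `g`-tree with minimum label `1` is an opening. -/
theorem exists_opened_equiv (t : RootedLabelledMap) (ht : t.M.IsGTree g n)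
    (hrot : ∀ d, t.lab (t.M.rot d) = t.lab d) (hrev : ∀ d, |t.lab (t.M.rev d) - t.lab d| ≤ 1)
    (hmin : IsLeast (Set.range t.lab) 1) (s : ℤˣ) :
    ∃ q : RootedPointedQuad g n, q.opened ≈ t ∧ q.sign = s := by
  have : Finite t.D := t.finite_D
  have : Nonempty t.D := ⟨t.root⟩
  have hT : t.M.IsLabelledOneFace t.lab :=
    { rev_rev := ht.rev_rev
      rev_ne := ht.rev_ne
      next_sameCycle := natCard_face_eq_one_iff.1 ht.card_face
      lab_rot := hrot
      lab_rev := hrev }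
  obtain ⟨o, ho⟩ := hmin.1
  have hQ := hT.closure_isQuad hmin
  have hψ := hT.closureEquiv_carries hmin ho
  obtain ⟨r, hr⟩ := hQ.openingRoot_arcSign_surjective ((hT.closure hmin).vertex (o, false))
    (hT.closureEquiv hmin ho t.root, s)
  obtain ⟨hr1, hr2⟩ := Prod.mk.inj hr
  refine ⟨⟨{ D := t.D × Bool
             finite_D := inferInstance
             M := hT.closure hmin
             root := r
             base := (hT.closure hmin).vertex (o, false) },
    hQ.isBipartiteQuadrangulation ht hψ⟩, Setoid.symm ⟨hT.closureEquiv hmin ho, hψ, hr1.symm,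
      fun d => hT.distLabel_closureEquiv hmin ho d⟩, hr2⟩

end RootedPointedQuad

theorem RootedLabelledMap.relabel_equiv {t t' : RootedLabelledMap} (h : t ≈ t') :
    t.relabel ≈ t'.relabel := by
  obtain ⟨e, he, hr, hl⟩ := h
  refine ⟨e, he, hr, fun d => ?_⟩
  have h1 := hl t.root
  rw [hr] at h1
  exact congrArg₂ (fun a b : ℤ => a - b + 1) (hl d) h1

theorem RootedPointedQuad.exists_relabel_opened_equiv {g n : ℕ} (t : RootedEmbeddedTree g n)
    (s : ℤˣ) : ∃ q : RootedPointedQuad g n, q.opened.relabel ≈ t.1 ∧ q.sign = s := by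
  obtain ⟨t, ht, he⟩ := t
  have : Finite t.D := t.finite_D
  have : Nonempty t.D := ⟨t.root⟩
  obtain ⟨o, ho⟩ := Finite.exists_min t.lab
  let t' : RootedLabelledMap :=
    { toRootedMap := t.toRootedMap, lab := fun d => t.lab d - t.lab o + 1 }
  obtain ⟨q, hq, hs⟩ := RootedPointedQuad.exists_opened_equiv (g := g) (n := n) t' ht
    (fun d => by simp only [t', he.lab_rot])
    (fun d => by
      have := he.lab_rev d
      simp only [t']
      convert this using 2
      ring)
    ⟨⟨o, by simp [t']⟩, by
      rintro _ ⟨d, rfl⟩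
      have := ho d
      simp only [t']
      omega⟩ s
  refine ⟨q, Setoid.trans (RootedLabelledMap.relabel_equiv hq)
    ⟨Equiv.refl _, .refl _, rfl, fun d => ?_⟩, hs⟩
  change t.lab d = (t.lab d - t.lab o + 1) - (t.lab t.root - t.lab o + 1) + 1
  rw [he.lab_root]
  ring

namespace RootedQuad

variable {g n : ℕ}

theorem sign_pointAtRoot (q : RootedQuad g n) : q.pointAtRoot.sign = 1 := by
  rw [RootedPointedQuad.sign_eq, arcSign_eq_one_iff, ← distLabel_next, ← isMarked_next_iff]
  exact q.pointAtRoot.isQuad.isMarked_next_of_distLabel_eq_zero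
    ((distLabel_eq_zero_iff q.2.connected _).2 rfl)

theorem opened_isWellLabelled (q : RootedQuad g n) : q.pointAtRoot.opened.IsWellLabelled where
  lab_rot := q.pointAtRoot.opened_isLabelledOneFace.lab_rot
  lab_rev := q.pointAtRoot.opened_isLabelledOneFace.lab_rev
  lab_root := by
    rw [q.pointAtRoot.opened_lab_root q.sign_pointAtRoot]
    have h : q.pointAtRoot.1.M.distLabel q.pointAtRoot.1.base q.pointAtRoot.1.root = 0 :=
      (distLabel_eq_zero_iff q.2.connected _).2 rfl
    rw [h]
    rfl
  isLeast := q.pointAtRoot.isLeast_opened_lab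

theorem pointAtRoot_equiv {q q' : RootedQuad g n} (h : q.1 ≈ q'.1) :
    q.pointAtRoot.1 ≈ q'.pointAtRoot.1 := by
  obtain ⟨e, he, hr⟩ := h
  refine ⟨e, he, hr, ?_⟩
  change ∀ d : q.1.D, q.1.M.vertex d = q.1.M.vertex q.1.root ↔
    q'.1.M.vertex (e d) = q'.1.M.vertex q'.1.root
  intro d
  rw [vertex_eq_iff, vertex_eq_iff, sameCycle_iff_of_conj e he.1, hr]

theorem exists_pointAtRoot_opened_equiv (t : RootedWellLabelledTree g n) :
    ∃ q : RootedQuad g n, q.pointAtRoot.opened ≈ t.1 := by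
  obtain ⟨t, ht, hw⟩ := t
  obtain ⟨q, hq, hs⟩ := RootedPointedQuad.exists_opened_equiv (g := g) (n := n) t ht
    hw.lab_rot hw.lab_rev hw.isLeast 1
  have h1 := q.opened_lab_root hs
  have h2 : q.opened.lab q.opened.root = 1 := by
    obtain ⟨e, -, hr, hl⟩ := hq
    rw [← hl, hr, hw.lab_root]
  have h3 : q.1.M.vertex q.1.root = q.1.base :=
    (distLabel_eq_zero_iff q.2.connected _).1 (by omega)
  refine ⟨⟨q.1.toRootedMap, q.2⟩, ?_⟩
  have h4 : RootedQuad.pointAtRoot ⟨q.1.toRootedMap, q.2⟩ = q := by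
    obtain ⟨⟨m, b⟩, hq⟩ := q
    simp only at h3
    subst h3
    rfl
  rwa [h4]

theorem exists_bijective_wellLabelledTree (g n : ℕ) :
    ∃ Φ : RootedQuadClass g n → RootedWellLabelledTreeClass g n,
      Function.Bijective Φ ∧
      ∀ q : RootedQuad g n,
        ∃ h : q.pointAtRoot.opened.M.IsGTree g n ∧ q.pointAtRoot.opened.IsWellLabelled,
          Φ (Quotient.mk _ q) = Quotient.mk _ ⟨q.pointAtRoot.opened, h⟩ := by
  have hw : ∀ q : RootedQuad g n,
      q.pointAtRoot.opened.M.IsGTree g n ∧ q.pointAtRoot.opened.IsWellLabelled :=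
    fun q => ⟨q.pointAtRoot.opened_isGTree, q.opened_isWellLabelled⟩
  refine ⟨Quotient.lift (fun q : RootedQuad g n => Quotient.mk _ ⟨q.pointAtRoot.opened, hw q⟩) fun q q' h =>
    Quotient.sound (RootedPointedQuad.opened_equiv_of_equiv (pointAtRoot_equiv h)).1,
    ⟨?_, ?_⟩, fun q => ⟨hw q, rfl⟩⟩
  · intro x y
    refine Quotient.inductionOn₂ x y fun (q q' : RootedQuad g n) h => Quotient.sound ?_
    have h1 : q.pointAtRoot.opened ≈ q'.pointAtRoot.opened :=
      Quotient.exact (s := RootedLabelledMap.setoid.comap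
        (Subtype.val : RootedWellLabelledTree g n → RootedLabelledMap)) h
    obtain ⟨e, he, hr, -⟩ := RootedPointedQuad.equiv_of_opened_equiv h1
      (q.sign_pointAtRoot.trans q'.sign_pointAtRoot.symm)
    exact ⟨e, he, hr⟩
  · intro y
    induction y using Quotient.inductionOn with
    | h t =>
      obtain ⟨q, hq⟩ := exists_pointAtRoot_opened_equiv t
      exact ⟨Quotient.mk _ q, Quotient.sound hq⟩

end RootedQuad

namespace RootedPointedQuad

theorem exists_bijective_embeddedTree (g n : ℕ) :
    ∃ Φ : RootedPointedQuadClass g n → RootedEmbeddedTreeClass g n × ℤˣ,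
      Function.Bijective Φ ∧
      ∀ q : RootedPointedQuad g n,
        ∃ h : q.opened.relabel.M.IsGTree g n ∧ q.opened.relabel.IsEmbedded,
          Φ (Quotient.mk _ q) = (Quotient.mk _ ⟨q.opened.relabel, h⟩, q.sign) := by
  have hw : ∀ q : RootedPointedQuad g n,
      q.opened.relabel.M.IsGTree g n ∧ q.opened.relabel.IsEmbedded :=
    fun q => ⟨q.opened_isGTree, q.relabel_opened_isEmbedded⟩
  refine ⟨Quotient.lift (fun q : RootedPointedQuad g n =>
    (Quotient.mk _ ⟨q.opened.relabel, hw q⟩, q.sign)) fun q q' h =>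
    Prod.ext (Quotient.sound (RootedLabelledMap.relabel_equiv (opened_equiv_of_equiv h).1))
      (opened_equiv_of_equiv h).2, ⟨?_, ?_⟩, fun q => ⟨hw q, rfl⟩⟩
  · intro x y
    refine Quotient.inductionOn₂ x y fun (q q' : RootedPointedQuad g n) h => Quotient.sound ?_
    obtain ⟨h1, h2⟩ := Prod.mk.inj h
    have h3 : q.opened.relabel ≈ q'.opened.relabel :=
      Quotient.exact (s := RootedLabelledMap.setoid.comap
        (Subtype.val : RootedEmbeddedTree g n → RootedLabelledMap)) h1
    exact equiv_of_opened_equiv (opened_equiv_of_relabel_equiv h3) h2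
  · rintro ⟨y, s⟩
    induction y using Quotient.inductionOn with
    | h t =>
      obtain ⟨q, hq, hs⟩ := exists_relabel_opened_equiv t s
      exact ⟨Quotient.mk _ q, Prod.ext (Quotient.sound hq) hs⟩

end RootedPointedQuad

/-! ### Enumeration -/

theorem finite_rootedPointedQuadClass (g n : ℕ) : Finite (RootedPointedQuadClass g n) := by
  have hcard : ∀ q : RootedPointedQuad g n, Nat.card q.1.D = 4 * n := fun q => by
    have : Finite q.1.D := q.1.finite_D
    rw [natCard_eq_four_mul_face q.2.degree_eq_four, q.2.card_face]
  have hex : ∀ q : RootedPointedQuad g n, Nonempty (q.1.D ≃ Fin (4 * n)) := fun q => by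
    have : Finite q.1.D := q.1.finite_D
    exact ⟨Finite.equivFinOfCardEq (hcard q)⟩
  let e (q : RootedPointedQuad g n) := (hex q).some
  let code (q : RootedPointedQuad g n) : (Fin (4 * n) → Fin (4 * n)) × (Fin (4 * n) → Fin (4 * n)) ×
      Fin (4 * n) × Set (Fin (4 * n)) :=
    (fun i => e q (q.1.M.rot ((e q).symm i)), fun i => e q (q.1.M.rev ((e q).symm i)),
      e q q.1.root, {i | q.1.M.vertex ((e q).symm i) = q.1.base})
  refine Finite.of_injective (fun Q => code (Quotient.out Q)) fun Q Q' h => ?_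
  rw [← Quotient.out_eq Q, ← Quotient.out_eq Q']
  simp only at h
  generalize Quotient.out Q = q at h ⊢
  generalize Quotient.out Q' = q' at h ⊢
  obtain ⟨h1, h⟩ := Prod.mk.inj h
  obtain ⟨h2, h⟩ := Prod.mk.inj h
  obtain ⟨h3, h4⟩ := Prod.mk.inj h
  refine Quotient.sound ⟨(e q).trans (e q').symm, ⟨fun d => ?_, fun d => ?_⟩, ?_, fun d => ?_⟩
  · have := congrFun h1 (e q d)
    simp only [Equiv.symm_apply_apply] at this
    simp [this]
  · have := congrFun h2 (e q d)
    simp only [Equiv.symm_apply_apply] at this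
    simp [this]
  · simp [h3]
  · have := Set.ext_iff.1 h4 (e q d)
    simpa using this

theorem finite_rootedEmbeddedTreeClass (g n : ℕ) : Finite (RootedEmbeddedTreeClass g n) := by
  obtain ⟨Φ, hΦ, -⟩ := RootedPointedQuad.exists_bijective_embeddedTree g n
  have := finite_rootedPointedQuadClass g n
  exact Finite.of_surjective (fun x => (Φ x).1) fun t => by
    obtain ⟨x, hx⟩ := hΦ.2 (t, 1)
    exact ⟨x, congrArg Prod.fst hx⟩

theorem natCard_rootedPointedQuadClass (g n : ℕ) :
    Nat.card (RootedPointedQuadClass g n) = 2 * Nat.card (RootedEmbeddedTreeClass g n) := by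
  obtain ⟨Φ, hΦ, -⟩ := RootedPointedQuad.exists_bijective_embeddedTree g n
  have hu : Nat.card ℤˣ = 2 := by simp [Nat.card_eq_fintype_card]
  rw [Nat.card_congr (Equiv.ofBijective Φ hΦ), Nat.card_prod, hu, mul_comm]

theorem pointedQuadCount_eq (g n : ℕ) : pointedQuadCount g n = 2 * embeddedTreeCount g n := by
  unfold pointedQuadCount embeddedTreeCount
  split_ifs
  · rfl
  · exact natCard_rootedPointedQuadClass g n

theorem isEmpty_rootedEmbeddedTreeClass {g n : ℕ} (h : n < 2 * g) :
    IsEmpty (RootedEmbeddedTreeClass g n) := by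
  refine ⟨fun t => Quotient.inductionOn t ?_⟩
  rintro ⟨t, ht, -⟩
  have : Finite t.D := t.finite_D
  have : Nonempty t.M.Vertex := ⟨t.M.vertex t.root⟩
  have h1 : 0 < Nat.card t.M.Vertex := Nat.card_pos
  have h2 := ht.euler
  rw [ht.card_face, ht.card_edge] at h2
  omega

theorem embeddedTreeCount_eq_zero {g n : ℕ} (h : n < 2 * g) : embeddedTreeCount g n = 0 := by
  have := isEmpty_rootedEmbeddedTreeClass h
  rw [embeddedTreeCount, if_neg (by omega), Nat.card_of_isEmpty]

theorem mainTheorem2 (g : ℕ) :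
    (∀ n : ℕ, ∃ Φ : RootedQuadClass g n → RootedWellLabelledTreeClass g n,
      Function.Bijective Φ ∧
      ∀ q : RootedQuad g n,
        ∃ h : q.pointAtRoot.opened.M.IsGTree g n ∧ q.pointAtRoot.opened.IsWellLabelled,
          Φ (Quotient.mk _ q) = Quotient.mk _ ⟨q.pointAtRoot.opened, h⟩) ∧
    (∀ n : ℕ, ∃ Φ : RootedPointedQuadClass g n → RootedEmbeddedTreeClass g n × ℤˣ,
      Function.Bijective Φ ∧
      ∀ q : RootedPointedQuad g n,
        ∃ h : q.opened.relabel.M.IsGTree g n ∧ q.opened.relabel.IsEmbedded,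
          Φ (Quotient.mk _ q) = (Quotient.mk _ ⟨q.opened.relabel, h⟩, q.sign)) ∧
    (∀ n : ℕ, Finite (RootedPointedQuadClass g n) ∧ Finite (RootedEmbeddedTreeClass g n)) ∧
    (∀ n : ℕ, n < 2 * g → pointedQuadCount g n = 0 ∧ embeddedTreeCount g n = 0) ∧
    pointedQuadSeries g = 2 * embeddedTreeSeries g := by
  refine ⟨RootedQuad.exists_bijective_wellLabelledTree g,
    RootedPointedQuad.exists_bijective_embeddedTree g,
    fun n => ⟨finite_rootedPointedQuadClass g n, finite_rootedEmbeddedTreeClass g n⟩,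
    fun n hn => ?_, ?_⟩
  · rw [pointedQuadCount_eq, embeddedTreeCount_eq_zero hn]
    exact ⟨rfl, rfl⟩
  · ext n
    rw [two_mul, map_add, pointedQuadSeries, embeddedTreeSeries, PowerSeries.coeff_mk,
      PowerSeries.coeff_mk, pointedQuadCount_eq]
    push_cast
    ring
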